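/- Let $F_{13}$ be the cubic graph with the twelve vertices $A,B,C,1,2,\dots,9$ and the eighteen edges $12,23,34,45,56,67,78,89,91$ and $A1,A4,A7,B2,B5,B8,C3,C6,C9$. For a simple graph $G$, let $G\cup e$ denote any multigraph obtained from $G$ by adding an edge $e$ in one of the following three ways: (i) subdivide an edge of $G$ once by a new vertex $u$, and add a new vertex $v$, the edge $uv$ and a loop at $v$; (ii) subdivide an edge of $G$ twice by new vertices $u$ and $v$, and add a further edge $uv$, parallel to the one created by the subdivision; (iii) subdivide two distinct edges $e_1,e_2$ of $G$ once each, by new vertices $u$ and $v$ respectively, and add the edge $uv$; this choice of $e$ is written $e_1-e_2$. Then $F_{13}\cup e$ is toroidal, that is, it embeds into the torus, for all choices of $e$. Moreover, up to the symmetries of $F_{13}$ there are exactly ten choices of $e$ such that $F_{13}\cup e$ has girth at least four (where a loop is a cycle of length one and a pair of parallel edges is a cycle of length two): each of the ten choices $A1-B2$, $A1-C3$, $A1-B5$, $A1-23$, $A1-34$, $A1-45$, $A1-56$, $12-34$, $12-45$, $12-56$ gives a graph of girth at least four, and for every choice of $e$ with $F_{13}\cup e$ of girth at least four, exactly one of these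 ten choices $e_1-e_2$ is such that some automorphism of $F_{13}$ maps the set of edges to which $e$ is attached onto $\{e_1,e_2\}$. -/

import Mathlib

namespace ToroidalGraphs

open Graph

/-! ### Embeddings of multigraphs into surfaces -/

/-- An embedding of a multigraph `G` into a topological space `X`: distinct vertices go to distinct
points, every edge goes to a continuous curve joining the images of its ends, which is simple
(apart from the ends, which coincide exactly for a loop), and the curves meet each other and the
images of the vertices only at images of common ends. -/
structure Embedding {α β : Type*} (G : Graph α β) (X : Type*) [TopologicalSpace X] where
  vert : α → X
  arc : β → C(unitInterval, X)
  vert_injOn : Set.InjOn vert V(G)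
  arc_ends : ∀ e x y, G.IsLink e x y →
    (arc e 0 = vert x ∧ arc e 1 = vert y) ∨ (arc e 0 = vert y ∧ arc e 1 = vert x)
  arc_injOn : ∀ e ∈ E(G), Set.InjOn (arc e) (Set.Ioo 0 1)
  arc_ne_vert : ∀ e ∈ E(G), ∀ t ∈ Set.Ioo (0 : unitInterval) 1, ∀ x ∈ V(G), arc e t ≠ vert x
  arc_ne_arc : ∀ e ∈ E(G), ∀ f ∈ E(G), e ≠ f →
    ∀ s ∈ Set.Ioo (0 : unitInterval) 1, ∀ t ∈ Set.Ioo (0 : unitInterval) 1, arc e s ≠ arc f t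

/-- The torus `ℝ/ℤ × ℝ/ℤ`. -/
abbrev Torus : Type := UnitAddCircle × UnitAddCircle

/-- A multigraph is toroidal if it embeds into the torus. -/
def Toroidal {α β : Type*} (G : Graph α β) : Prop := Nonempty (Embedding G Torus)

/-! ### Cycles and girth of multigraphs -/

/-- `G` contains a cycle of length `n`; a loop is a cycle of length one, and two parallel edges
form a cycle of length two. -/
def HasCycle {α β : Type*} (G : Graph α β) (n : ℕ) : Prop :=
  0 < n ∧ ∃ (v : ZMod n → α) (c : ZMod n → β), Function.Injective v ∧ Function.Injective c ∧
    ∀ i, G.IsLink (c i) (v i) (v (i + 1))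

/-- The length of a shortest cycle (infinite if there is none). -/
noncomputable def girth {α β : Type*} (G : Graph α β) : ℕ∞ :=
  ⨅ n : {n : ℕ // HasCycle G n}, ((n : ℕ) : ℕ∞)

/-! ### Adding an edge to a graph -/

/-- The choices of an edge `e` that can be added to a graph `G`. -/
inductive EdgeChoice {V : Type*} (G : SimpleGraph V) : Type _
  /-- Subdivide the edge `xy` once by `u`; add a vertex `v`, the edge `uv` and a loop at `v`. -/
  | pendant (x y : V) (h : G.Adj x y)
  /-- Subdivide the edge `xy` twice by `u` and `v`; add a further edge `uv`. -/
  | same (x y : V) (h : G.Adj x y)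
  /-- Subdivide the distinct edges `x₁y₁` by `u` and `x₂y₂` by `v`; add the edge `uv`. -/
  | across (x₁ y₁ x₂ y₂ : V) (h₁ : G.Adj x₁ y₁) (h₂ : G.Adj x₂ y₂) (hne : s(x₁, y₁) ≠ s(x₂, y₂))

namespace EdgeChoice

variable {V : Type*} {G : SimpleGraph V}

/-- The edges of `G` to which `e` is attached, that is, which are subdivided. -/
def attached : EdgeChoice G → Set (Sym2 V)
  | pendant x y _ => {s(x, y)}
  | same x y _ => {s(x, y)}
  | across x₁ y₁ x₂ y₂ _ _ _ => {s(x₁, y₁), s(x₂, y₂)}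

/-- The list of edges of `G ∪ e` that are not edges of `G`, where `u` is `Sum.inr 0` and `v` is
`Sum.inr 1`. -/
def newEdges : EdgeChoice G → List (Sym2 (V ⊕ Fin 2))
  | pendant x y _ =>
      [s(.inl x, .inr 0), s(.inr 0, .inl y), s(.inr 0, .inr 1), s(.inr 1, .inr 1)]
  | same x y _ =>
      [s(.inl x, .inr 0), s(.inr 0, .inr 1), s(.inr 1, .inl y), s(.inr 0, .inr 1)]
  | across x₁ y₁ x₂ y₂ _ _ _ =>
      [s(.inl x₁, .inr 0), s(.inr 0, .inl y₁), s(.inl x₂, .inr 1), s(.inr 1, .inl y₂),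
        s(.inr 0, .inr 1)]

/-- The incidence relation of `G ∪ e`. An edge is labelled either by an edge of `G` which is not
subdivided, or by its position in the list of new edges. -/
def Link (e : EdgeChoice G) : Sym2 V ⊕ ℕ → V ⊕ Fin 2 → V ⊕ Fin 2 → Prop
  | .inl f, a, b => f ∈ G.edgeSet ∧ f ∉ e.attached ∧ f.map Sum.inl = s(a, b)
  | .inr i, a, b => e.newEdges[i]? = some s(a, b)

end EdgeChoice

/-- The multigraph `G ∪ e`. -/
def addEdge {V : Type*} (G : SimpleGraph V) (e : EdgeChoice G) :
    Graph (V ⊕ Fin 2) (Sym2 V ⊕ ℕ) where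
  vertexSet := Set.univ
  IsLink := e.Link
  isLink_symm := by
    rintro (f | i) - <;> constructor <;> intro a b h
    · exact ⟨h.1, h.2.1, h.2.2.trans Sym2.eq_swap⟩
    · exact Eq.trans h (congrArg some Sym2.eq_swap)
  eq_or_eq_of_isLink_of_isLink := by
    rintro (f | i) x y v w h h'
    · have := h.2.2.symm.trans h'.2.2
      rw [Sym2.eq_iff] at this
      tauto
    · have := Option.some.inj (Eq.trans (Eq.symm h) h')
      rw [Sym2.eq_iff] at this
      tauto
  left_mem_of_isLink := fun _ _ _ _ => Set.mem_univ _

/-! ### The graph `F₁₃` -/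

/-- The vertices `A`, `B`, `C` are `Sum.inl 0`, `Sum.inl 1`, `Sum.inl 2`; the vertex `i`, for
`1 ≤ i ≤ 9`, is `Sum.inr i` with `i` read modulo `9`. -/
abbrev F13Vertex : Type := Fin 3 ⊕ Fin 9

namespace F13Vertex

abbrev A : F13Vertex := .inl 0
abbrev B : F13Vertex := .inl 1
abbrev C : F13Vertex := .inl 2
/-- The vertex with label `i` on the nine-cycle. -/
abbrev r (i : Fin 9) : F13Vertex := .inr i

end F13Vertex

open F13Vertex

/-- The edges of `F₁₃`, each listed once: the nine-cycle `12…9`, and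
`A1, A4, A7, B2, B5, B8, C3, C6, C9`. -/
def f13Edges : Finset (Sym2 F13Vertex) :=
  {s(r 1, r 2), s(r 2, r 3), s(r 3, r 4), s(r 4, r 5), s(r 5, r 6), s(r 6, r 7), s(r 7, r 8),
    s(r 8, r 9), s(r 9, r 1), s(A, r 1), s(A, r 4), s(A, r 7), s(B, r 2), s(B, r 5), s(B, r 8),
    s(C, r 3), s(C, r 6), s(C, r 9)}

/-- The cubic graph `F₁₃` on twelve vertices. -/
def F13 : SimpleGraph F13Vertex where
  Adj x y := s(x, y) ∈ f13Edges
  symm := ⟨fun x y h => by rwa [Sym2.eq_swap]⟩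
  loopless := ⟨by decide⟩

instance : DecidableRel F13.Adj := fun x y => inferInstanceAs (Decidable (s(x, y) ∈ f13Edges))

/-- The ten choices `A1-B2`, `A1-C3`, `A1-B5`, `A1-23`, `A1-34`, `A1-45`, `A1-56`, `12-34`, `12-45`,
`12-56`. -/
def tenCases : Fin 10 → EdgeChoice F13 :=
  ![.across A (r 1) B (r 2) (by decide) (by decide) (by decide),
    .across A (r 1) C (r 3) (by decide) (by decide) (by decide),
    .across A (r 1) B (r 5) (by decide) (by decide) (by decide),
    .across A (r 1) (r 2) (r 3) (by decide) (by decide) (by decide),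
    .across A (r 1) (r 3) (r 4) (by decide) (by decide) (by decide),
    .across A (r 1) (r 4) (r 5) (by decide) (by decide) (by decide),
    .across A (r 1) (r 5) (r 6) (by decide) (by decide) (by decide),
    .across (r 1) (r 2) (r 3) (r 4) (by decide) (by decide) (by decide),
    .across (r 1) (r 2) (r 4) (r 5) (by decide) (by decide) (by decide),
    .across (r 1) (r 2) (r 5) (r 6) (by decide) (by decide) (by decide)]

end ToroidalGraphs

namespace ToroidalGraphs

open Set Graph F13Vertex

/-! The dihedral group of order eighteen acts on `F13` by `i ↦ ±i + j` on the nine-cycle, with `A`,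
`B`, `C` following the residues modulo three. It has two orbits of edges, the nine-cycle ("ring")
and the edges at `A`, `B`, `C` ("spokes"). It has thirteen orbits of pairs of distinct edges: four
of ring edges, four of spokes, five mixed.

Toroidality. One straight-line drawing of `F13` on the flat torus is fixed. Each of the thirteen
orbits contains a pair of edges on a common face, so these edges can be subdivided and joined across
that face. A pendant loop or a doubled edge is drawn near one edge of each edge orbit. All other
choices of `e` follow by symmetry (`EdgeChoice.toroidal_of_map`) and by relabelling the new vertices
and edges (`EdgeChoice.toroidal_of_relabel`). That a picture is an embedding is reduced by
`toroidal_of_isDrawing` and `Cell.disjoint_of_apartMod` to comparisons of natural numbers, which are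
settled by evaluation.

Girth. Choices (i) and (ii) create cycles of length one and two, and choice (iii) creates a triangle
when the two edges share an end. If they are disjoint, the girth is at least four because `F13` has
no triangle (`EdgeChoice.four_le_girth_across`). The orbits of `A1-A4`, `A1-12` and `12-23` are the
three with a common end, which leaves ten. That these ten are inequivalent under all automorphisms
requires that `F13` has no automorphism outside the dihedral group (`exists_eq_dihedral`). -/

/-! ### Arcs in a topological space -/

/-- There is a curve from `x` to `y`, simple apart from its ends, whose interior lies in `S`. -/
def HasArc {X : Type*} [TopologicalSpace X] (S : Set X) (x y : X) : Prop :=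
  ∃ f : C(unitInterval, X), f 0 = x ∧ f 1 = y ∧ InjOn f (Ioo 0 1) ∧
    ∀ t ∈ Ioo (0 : unitInterval) 1, f t ∈ S

theorem HasArc.trans {X : Type*} [TopologicalSpace X] {S T : Set X} {x y z : X}
    (h₁ : HasArc S x y) (h₂ : HasArc T y z) (hS : y ∉ S) (hT : y ∉ T) (hST : Disjoint S T) :
    HasArc (S ∪ {y} ∪ T) x z := by
  obtain ⟨f, f0, f1, finj, fS⟩ := h₁
  obtain ⟨g, g0, g1, ginj, gT⟩ := h₂
  let γ : Path x y := ⟨f, f0, f1⟩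
  let δ : Path y z := ⟨g, g0, g1⟩
  -- An interior parameter falls in the first half, at the junction or in the second half. The
  -- images of the three pieces are disjoint, so injectivity can be checked on each piece.
  have key : ∀ t ∈ Ioo (0 : unitInterval) 1,
      (∃ s ∈ Ioo (0 : unitInterval) 1, (s : ℝ) = 2 * t ∧ γ.trans δ t = f s) ∨
      ((t : ℝ) = 1 / 2 ∧ γ.trans δ t = y) ∨
      (∃ s ∈ Ioo (0 : unitInterval) 1, (s : ℝ) = 2 * t - 1 ∧ γ.trans δ t = g s) := by
    rintro t ⟨ht0, ht1⟩
    have h0 : (0 : ℝ) < t := ht0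
    have h1 : (t : ℝ) < 1 := ht1
    rcases lt_trichotomy (t : ℝ) (1 / 2) with h | h | h
    · refine .inl ⟨⟨2 * t, by linarith, by linarith⟩, ⟨?_, ?_⟩, rfl, ?_⟩
      · change (0 : ℝ) < 2 * t
        linarith
      · change 2 * (t : ℝ) < 1
        linarith
      · rw [Path.trans_apply, dif_pos h.le]
        rfl
    · refine .inr (.inl ⟨h, ?_⟩)
      rw [Path.trans_apply, dif_pos h.le]
      convert γ.target
      simp [h]
    · refine .inr (.inr ⟨⟨2 * t - 1, by linarith, by linarith⟩, ⟨?_, ?_⟩, rfl, ?_⟩)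
      · change (0 : ℝ) < 2 * t - 1
        linarith
      · change 2 * (t : ℝ) - 1 < 1
        linarith
      · rw [Path.trans_apply, dif_neg (not_le.2 h)]
        rfl
  refine ⟨(γ.trans δ).toContinuousMap, (γ.trans δ).source, (γ.trans δ).target, ?_, ?_⟩
  · intro s hs t ht hst
    change γ.trans δ s = γ.trans δ t at hst
    have hne : ∀ a ∈ S, ∀ b ∈ T, a ≠ b := fun a ha b hb => (hST.ne_of_mem ha hb)
    apply Subtype.ext
    rcases key s hs with ⟨a, ha, ha', hs'⟩ | ⟨ha', hs'⟩ | ⟨a, ha, ha', hs'⟩ <;>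
    rcases key t ht with ⟨b, hb, hb', ht'⟩ | ⟨hb', ht'⟩ | ⟨b, hb, hb', ht'⟩ <;>
    rw [hs', ht'] at hst
    · have := congrArg Subtype.val (finj ha hb hst)
      linarith
    · exact absurd (hst ▸ fS a ha) hS
    · exact absurd hst (hne _ (fS a ha) _ (gT b hb))
    · exact absurd (hst ▸ fS b hb) hS
    · linarith
    · exact absurd (hst ▸ gT b hb) hT
    · exact absurd hst.symm (hne _ (fS b hb) _ (gT a ha))
    · exact absurd (hst ▸ gT a ha) hT
    · have := congrArg Subtype.val (ginj ha hb hst)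
      linarith
  · intro t ht
    change γ.trans δ t ∈ _
    rcases key t ht with ⟨a, ha, -, h⟩ | ⟨-, h⟩ | ⟨a, ha, -, h⟩ <;> rw [h]
    · exact .inl (.inl (fS a ha))
    · exact .inl (.inr rfl)
    · exact .inr (gT a ha)

theorem HasArc.mono {X : Type*} [TopologicalSpace X] {S T : Set X} {x y : X}
    (h : HasArc S x y) (hST : S ⊆ T) : HasArc T x y := by
  obtain ⟨f, h0, h1, hi, hS⟩ := h
  exact ⟨f, h0, h1, hi, fun t ht => hST (hS t ht)⟩

/-! ### Polygonal arcs in the torus -/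

/-- The point of the torus with coordinates `p.1`, `p.2`, measured in tenths. -/
noncomputable def torusPoint (p : ℝ × ℝ) : Torus :=
  (((p.1 / 10 : ℝ) : UnitAddCircle), ((p.2 / 10 : ℝ) : UnitAddCircle))

theorem coe_div_ten_eq_iff (a b : ℝ) :
    ((a / 10 : ℝ) : UnitAddCircle) = ((b / 10 : ℝ) : UnitAddCircle) ↔ ∃ n : ℤ, a = b + 10 * n := by
  rw [← sub_eq_zero, ← AddCircle.coe_sub, AddCircle.coe_eq_zero_iff]
  constructor
  · rintro ⟨n, hn⟩
    refine ⟨n, ?_⟩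
    simp only [zsmul_eq_mul, mul_one] at hn
    linarith
  · rintro ⟨n, hn⟩
    refine ⟨n, ?_⟩
    simp only [zsmul_eq_mul, mul_one]
    linarith

theorem torusPoint_eq_iff (p q : ℝ × ℝ) :
    torusPoint p = torusPoint q ↔ ∃ m n : ℤ, p.1 = q.1 + 10 * m ∧ p.2 = q.2 + 10 * n := by
  simp only [torusPoint, Prod.mk.injEq, coe_div_ten_eq_iff]
  constructor
  · rintro ⟨⟨m, hm⟩, n, hn⟩
    exact ⟨m, n, hm, hn⟩
  · rintro ⟨m, n, hm, hn⟩
    exact ⟨⟨m, hm⟩, n, hn⟩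

theorem continuous_torusPoint : Continuous torusPoint := by
  unfold torusPoint
  have h : Continuous ((↑) : ℝ → UnitAddCircle) := AddCircle.continuous_mk' 1
  exact (h.comp (by fun_prop)).prodMk (h.comp (by fun_prop))

/-- The point of the torus with integral coordinates, measured in tenths. -/
noncomputable def gridPoint (p : ℕ × ℕ) : Torus := torusPoint (p.1, p.2)

theorem gridPoint_eq_of_mod_eq {p q : ℕ × ℕ} (h₁ : p.1 % 10 = q.1 % 10) (h₂ : p.2 % 10 = q.2 % 10) :
    gridPoint p = gridPoint q := by
  have key : ∀ a b : ℕ, a % 10 = b % 10 → ∃ m : ℤ, (a : ℝ) = b + 10 * m := fun a b h => by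
    obtain ⟨m, hm⟩ := (Nat.modEq_iff_dvd.1 (show b ≡ a [MOD 10] from h.symm))
    refine ⟨m, ?_⟩
    have : (a : ℤ) = b + 10 * m := by
      push_cast at hm
      linarith
    exact_mod_cast this
  obtain ⟨m, hm⟩ := key _ _ h₁
  obtain ⟨n, hn⟩ := key _ _ h₂
  exact (torusPoint_eq_iff _ _).2 ⟨m, n, hm, hn⟩

/-- A segment with integral ends, possibly degenerate. -/
abbrev Cell : Type := (ℕ × ℕ) × (ℕ × ℕ)

namespace Cell

/-- The point which divides a segment in the ratio `t : 1 - t`. -/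
def point (P : Cell) (t : ℝ) : ℝ × ℝ :=
  (P.1.1 + t * (P.2.1 - P.1.1), P.1.2 + t * (P.2.2 - P.1.2))

/-- The image of an open segment in the torus. -/
def carrier (P : Cell) : Set Torus := {z | ∃ t ∈ Ioo (0 : ℝ) 1, torusPoint (P.point t) = z}

/-- Vertices and corners are thus degenerate segments, and a single separation test serves for
points and segments. -/
theorem carrier_self (p : ℕ × ℕ) : carrier (p, p) = {gridPoint p} := by
  ext z
  simp only [carrier, point, gridPoint, sub_self, mul_zero, add_zero, mem_ofPred_eq,
    mem_singleton_iff]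
  exact ⟨fun ⟨t, _, h⟩ => h.symm, fun h => ⟨1 / 2, by norm_num, h.symm⟩⟩

/-- Both coordinates change by less than the circumference of the torus. -/
def IsShort (p q : ℕ × ℕ) : Prop :=
  p ≠ q ∧ (p.1 < q.1 + 10 ∧ q.1 < p.1 + 10) ∧ p.2 < q.2 + 10 ∧ q.2 < p.2 + 10

instance : DecidableRel IsShort := fun _ _ => inferInstanceAs (Decidable (_ ∧ (_ ∧ _) ∧ _ ∧ _))

/-- A segment shorter than the period in this coordinate cannot wrap around: `(s - t) * (d - c)` has
absolute value below ten, which forces `m = 0`. -/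
theorem eq_of_eq_add_period {c d : ℕ} (hcd : c < d + 10 ∧ d < c + 10) (hne : c ≠ d) {s t : ℝ}
    (hs : s ∈ Ioo (0 : ℝ) 1) (ht : t ∈ Ioo (0 : ℝ) 1) {m : ℤ}
    (h : (c + s * (d - c) : ℝ) = c + t * (d - c) + 10 * m) : s = t := by
  have hd : |(d - c : ℝ)| < 10 := by
    have h1 : (c : ℝ) < d + 10 := by exact_mod_cast hcd.1
    have h2 : (d : ℝ) < c + 10 := by exact_mod_cast hcd.2
    rw [abs_lt]
    constructor <;> linarith
  have hst : |s - t| < 1 := by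
    rw [abs_lt]
    constructor <;> linarith [hs.1, hs.2, ht.1, ht.2]
  have hm : (s - t) * (d - c) = 10 * m := by linarith
  have hlt : |(10 * m : ℝ)| < 10 := by
    rw [← hm, abs_mul]
    calc |s - t| * |(d - c : ℝ)| ≤ 1 * |(d - c : ℝ)| := by gcongr
      _ < 10 := by linarith
  have hm0 : m = 0 := by
    rw [abs_mul, abs_of_pos (by norm_num : (0 : ℝ) < 10)] at hlt
    have : |(m : ℝ)| < 1 := by linarith
    exact Int.abs_lt_one_iff.1 (by exact_mod_cast this)
  have hd0 : (d - c : ℝ) ≠ 0 := sub_ne_zero.2 (by exact_mod_cast hne.symm)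
  have h0 : (s - t) * (d - c) = 0 := by simpa [hm0] using hm
  exact sub_eq_zero.1 ((mul_eq_zero.1 h0).resolve_right hd0)

theorem hasArc_carrier {p q : ℕ × ℕ} (h : IsShort p q) :
    HasArc (carrier (p, q)) (gridPoint p) (gridPoint q) := by
  refine ⟨⟨fun t => torusPoint (point (p, q) t), ?_⟩, ?_, ?_, ?_, ?_⟩
  · refine continuous_torusPoint.comp ?_
    unfold point
    fun_prop
  · simp [point, gridPoint]
  · simp [point, gridPoint]
  · intro s hs t ht hst
    obtain ⟨m, n, hm, hn⟩ := (torusPoint_eq_iff _ _).1 hst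
    have hs' : (s : ℝ) ∈ Ioo (0 : ℝ) 1 := hs
    have ht' : (t : ℝ) ∈ Ioo (0 : ℝ) 1 := ht
    apply Subtype.ext
    by_cases h1 : p.1 = q.1
    · have h2 : p.2 ≠ q.2 := fun h2 => h.1 (Prod.ext h1 h2)
      exact eq_of_eq_add_period h.2.2 h2 hs' ht' hn
    · exact eq_of_eq_add_period h.2.1 h1 hs' ht' hm
  · intro t ht
    exact ⟨t, ht, rfl⟩

/-! ### Separation tests for open segments -/

/-- The first two numbers are at most the last two, and not all four of them are equal. -/
def below (a b c d : ℕ) : Bool := a.ble c && a.ble d && b.ble c && b.ble d && (a + b).blt (c + d)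

theorem lt_of_below {a b c d : ℕ} (h : below a b c d) {s t : ℝ} (hs : s ∈ Ioo (0 : ℝ) 1)
    (ht : t ∈ Ioo (0 : ℝ) 1) : (a + s * (b - a) : ℝ) < c + t * (d - c) := by
  simp only [below, Bool.and_eq_true, Nat.ble_eq, Nat.blt_eq] at h
  obtain ⟨⟨⟨⟨h1, h2⟩, h3⟩, h4⟩, h5⟩ := h
  have h1 : (0 : ℝ) ≤ c - a := sub_nonneg.2 (by exact_mod_cast h1)
  have h2 : (0 : ℝ) ≤ d - a := sub_nonneg.2 (by exact_mod_cast h2)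
  have h3 : (0 : ℝ) ≤ c - b := sub_nonneg.2 (by exact_mod_cast h3)
  have h4 : (0 : ℝ) ≤ d - b := sub_nonneg.2 (by exact_mod_cast h4)
  have h5 : (a + b : ℝ) < c + d := by exact_mod_cast h5
  obtain ⟨hs0, hs1⟩ := hs
  obtain ⟨ht0, ht1⟩ := ht
  have hs2 : 0 < 1 - s := by linarith
  have ht2 : 0 < 1 - t := by linarith
  -- The difference is a combination, with positive weights, of four nonnegative numbers, of which
  -- `c - a` and `d - b` have positive sum. Strictness in one place suffices, so open intervals with
  -- a common end are admitted.
  have e : (c + t * (d - c) : ℝ) - (a + s * (b - a)) = (1 - s) * (1 - t) * (c - a) +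
      (1 - s) * t * (d - a) + s * (1 - t) * (c - b) + s * t * (d - b) := by ring
  rw [← sub_pos, e]
  have p1 := mul_nonneg (mul_pos hs2 ht2).le h1
  have p2 := mul_nonneg (mul_pos hs2 ht0).le h2
  have p3 := mul_nonneg (mul_pos hs0 ht2).le h3
  have p4 := mul_nonneg (mul_pos hs0 ht0).le h4
  rcases h1.eq_or_lt with h | h
  · have p4' := mul_pos (mul_pos hs0 ht0) (by linarith : (0 : ℝ) < d - b)
    linarith
  · have p1' := mul_pos (mul_pos hs2 ht2) h
    linarith

/-- The positive part of the determinant which decides on which side of the line through the ends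
of `P` the point `q` lies. -/
def detPos (P : Cell) (q : ℕ × ℕ) : ℕ := P.1.1 * P.2.2 + P.2.1 * q.2 + q.1 * P.1.2

/-- The negative part of the determinant which decides on which side of the line through the ends
of `P` the point `q` lies. -/
def detNeg (P : Cell) (q : ℕ × ℕ) : ℕ := P.1.2 * P.2.1 + P.2.2 * q.1 + q.2 * P.1.1

/-- The inequalities `a ≤ b` and `c ≤ d` hold, and one of them is strict. -/
def dominated (a b c d : ℕ) : Bool := a.ble b && c.ble d && (a + c).blt (b + d)

theorem pos_of_dominated {a b c d : ℕ} (h : dominated a b c d) {t : ℝ} (ht : t ∈ Ioo (0 : ℝ) 1) :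
    (0 : ℝ) < (1 - t) * (b - a) + t * (d - c) := by
  simp only [dominated, Bool.and_eq_true, Nat.ble_eq, Nat.blt_eq] at h
  obtain ⟨⟨h1, h2⟩, h3⟩ := h
  have h1 : (0 : ℝ) ≤ b - a := sub_nonneg.2 (by exact_mod_cast h1)
  have h2 : (0 : ℝ) ≤ d - c := sub_nonneg.2 (by exact_mod_cast h2)
  have h3 : (a + c : ℝ) < b + d := by exact_mod_cast h3
  obtain ⟨ht0, ht1⟩ := ht
  have ht2 : 0 < 1 - t := by linarith
  rcases h1.eq_or_lt with h | h
  · have := mul_pos ht0 (by linarith : (0 : ℝ) < d - c)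
    rw [← h]
    linarith
  · have := mul_pos ht2 h
    have := mul_nonneg ht0.le h2
    linarith

/-- The open segment `Q` lies strictly on one side of the line through the ends of `P`. -/
def oneSide (P Q : Cell) : Bool :=
  dominated (detNeg P Q.1) (detPos P Q.1) (detNeg P Q.2) (detPos P Q.2) ||
    dominated (detPos P Q.1) (detNeg P Q.1) (detPos P Q.2) (detNeg P Q.2)

/-- The determinant `detPos - detNeg` is affine along `Q` and vanishes on the line through the ends
of `P`. As `s` is arbitrary, `Q` avoids that whole line. -/
theorem point_ne_of_oneSide {P Q : Cell} (h : oneSide P Q) {s t : ℝ} (ht : t ∈ Ioo (0 : ℝ) 1) :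
    P.point s ≠ Q.point t := by
  intro e
  have e1 := congrArg Prod.fst e
  have e2 := congrArg Prod.snd e
  simp only [point] at e1 e2
  have h0 : (1 - t) * ((detPos P Q.1 : ℝ) - detNeg P Q.1) +
      t * ((detPos P Q.2 : ℝ) - detNeg P Q.2) = 0 := by
    simp only [detPos, detNeg]
    push_cast
    linear_combination (P.2.2 - P.1.2 : ℝ) * e1 - (P.2.1 - P.1.1 : ℝ) * e2
  rw [oneSide, Bool.or_eq_true] at h
  rcases h with h | h
  · exact (pos_of_dominated h ht).ne' h0
  · have := pos_of_dominated h ht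
    linarith

/-- The translate of a segment by a vector of the period lattice. -/
def shift (P : Cell) (m n : ℕ) : Cell :=
  ((P.1.1 + 10 * m, P.1.2 + 10 * n), (P.2.1 + 10 * m, P.2.2 + 10 * n))

/-- One of two open intervals is separated from a translate of the other. -/
def intervalsApart (a b c d k : ℕ) : Bool :=
  below (a + 10) (b + 10) (c + 10 * k) (d + 10 * k) ||
    below (c + 10 * k) (d + 10 * k) (a + 10) (b + 10)

theorem ne_of_intervalsApart {a b c d k : ℕ} (h : intervalsApart a b c d k) {s t : ℝ}
    (hs : s ∈ Ioo (0 : ℝ) 1) (ht : t ∈ Ioo (0 : ℝ) 1) :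
    (a + s * (b - a) + 10 : ℝ) ≠ c + t * (d - c) + 10 * k := by
  intro e
  rw [intervalsApart, Bool.or_eq_true] at h
  rcases h with h | h
  · have := lt_of_below h hs ht
    push_cast at this
    linarith
  · have := lt_of_below h ht hs
    push_cast at this
    linarith

/-- The first segment is separated from each of the neighbouring translates of the second one by a
coordinate line or by the line through the ends of a segment. -/
def apartMod (P Q : Cell) : Bool :=
  [0, 1, 2].all fun m => intervalsApart P.1.1 P.2.1 Q.1.1 Q.2.1 m || [0, 1, 2].all fun n =>
    intervalsApart P.1.2 P.2.2 Q.1.2 Q.2.2 n ||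
      oneSide (P.shift 1 1) (Q.shift m n) || oneSide (Q.shift m n) (P.shift 1 1)

/-- The segment lies in the square of side length twenty. -/
def InBox (P : Cell) : Prop := (P.1.1 < 20 ∧ P.1.2 < 20) ∧ P.2.1 < 20 ∧ P.2.2 < 20

instance : DecidablePred InBox := fun _ => inferInstanceAs (Decidable ((_ ∧ _) ∧ _ ∧ _))

theorem convex_comb_mem {a b : ℕ} (ha : a < 20) (hb : b < 20) {t : ℝ}
    (ht : t ∈ Ioo (0 : ℝ) 1) : (a + t * (b - a) : ℝ) ∈ Ico (0 : ℝ) 20 := by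
  have h1 : (0 : ℝ) ≤ a := by positivity
  have h2 : (a : ℝ) < 20 := by exact_mod_cast ha
  have h3 : (0 : ℝ) ≤ b := by positivity
  have h4 : (b : ℝ) < 20 := by exact_mod_cast hb
  constructor <;> nlinarith [ht.1, ht.2]

/-- Numbers in `[0, 20)` differ by less than twenty, so `m` is -1, 0 or 1. Adding ten to `x` makes
the multiplier `k = m + 1` a natural number, hence the shift of `P` by `1 1` in `apartMod`. -/
theorem exists_of_eq_add_period {x y : ℝ} (hx : x ∈ Ico (0 : ℝ) 20) (hy : y ∈ Ico (0 : ℝ) 20)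
    {m : ℤ} (h : x = y + 10 * m) : ∃ k ∈ [0, 1, 2], x + 10 = y + 10 * (k : ℕ) := by
  have h1 : ((-2 : ℤ) : ℝ) < m := by
    push_cast
    linarith [hx.1, hy.2]
  have h2 : (m : ℝ) < (2 : ℤ) := by
    push_cast
    linarith [hx.2, hy.1]
  have h1 := Int.cast_lt.1 h1
  have h2 := Int.cast_lt.1 h2
  obtain ⟨k, hk⟩ := Int.eq_ofNat_of_zero_le (show 0 ≤ m + 1 by omega)
  refine ⟨k, ?_, ?_⟩
  · simp only [List.mem_cons, List.not_mem_nil, or_false]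
    omega
  · have : (m : ℝ) + 1 = k := by exact_mod_cast hk
    rw [h, ← this]
    ring

theorem disjoint_of_apartMod {P Q : Cell} (h : apartMod P Q) (hP : InBox P) (hQ : InBox Q) :
    Disjoint P.carrier Q.carrier := by
  rw [Set.disjoint_left]
  rintro z ⟨s, hs, rfl⟩ ⟨t, ht, e⟩
  obtain ⟨m, n, hm, hn⟩ := (torusPoint_eq_iff _ _).1 e.symm
  obtain ⟨k, hk, hk'⟩ := exists_of_eq_add_period (convex_comb_mem hP.1.1 hP.2.1 hs)
    (convex_comb_mem hQ.1.1 hQ.2.1 ht) hm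
  obtain ⟨l, hl, hl'⟩ := exists_of_eq_add_period (convex_comb_mem hP.1.2 hP.2.2 hs)
    (convex_comb_mem hQ.1.2 hQ.2.2 ht) hn
  have hpt : (P.shift 1 1).point s = (Q.shift k l).point t := by
    simp only [point, shift]
    push_cast
    ext
    · linarith
    · linarith
  have h := List.all_eq_true.1 h k hk
  rw [Bool.or_eq_true] at h
  rcases h with h | h
  · exact ne_of_intervalsApart h hs ht hk'
  · have h := List.all_eq_true.1 h l hl
    simp only [Bool.or_eq_true] at h
    rcases h with (h | h) | h
    · exact ne_of_intervalsApart h hs ht hl'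
    · exact point_ne_of_oneSide h ht hpt
    · exact point_ne_of_oneSide h hs hpt.symm

end Cell

/-! ### Polygonal drawings on the torus -/

/-- The open segments and the inner corners of a polygonal line. -/
def polyCells : List (ℕ × ℕ) → List Cell
  | [] => []
  | [_] => []
  | [p, q] => [(p, q)]
  | p :: q :: r :: l => (p, q) :: (q, q) :: polyCells (q :: r :: l)

/-- The union of the images of finitely many segments in the torus. -/
def region (L : List Cell) : Set Torus := {z | ∃ P ∈ L, z ∈ P.carrier}

/-- Every segment of one list is disjoint in the torus from every segment of the other. -/
def RegionsApart (L M : List Cell) : Prop := ∀ P ∈ L, ∀ Q ∈ M, Cell.apartMod P Q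

instance : DecidableRel RegionsApart := fun L M =>
  inferInstanceAs (Decidable (∀ P ∈ L, ∀ Q ∈ M, Cell.apartMod P Q))

theorem RegionsApart.disjoint {L M : List Cell} (h : RegionsApart L M)
    (hL : ∀ P ∈ L, P.InBox) (hM : ∀ P ∈ M, P.InBox) : Disjoint (region L) (region M) := by
  rw [Set.disjoint_left]
  rintro z ⟨P, hP, hz⟩ ⟨Q, hQ, hz'⟩
  exact Set.disjoint_left.1 (Cell.disjoint_of_apartMod (h P hP Q hQ) (hL P hP) (hM Q hQ)) hz hz'

/-- Induction on the line. The corner `b` is itself a cell, so pairwise separation of the cells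
supplies all three disjointness hypotheses of `HasArc.trans`. -/
theorem hasArc_region : ∀ (l : List (ℕ × ℕ)) (p q : ℕ × ℕ), l.head? = some p →
    l.getLast? = some q → 2 ≤ l.length → l.IsChain Cell.IsShort →
    ((polyCells l).Pairwise fun P Q => Cell.apartMod P Q) → (∀ P ∈ polyCells l, P.InBox) →
    HasArc (region (polyCells l)) (gridPoint p) (gridPoint q)
  | [], _, _, hp, _, _, _, _, _ => by simp at hp
  | [_], _, _, _, _, hl, _, _, _ => by simp at hl
  | [a, b], p, q, hp, hq, _, hs, _, _ => by
    simp only [List.head?_cons, Option.some.injEq] at hp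
    simp only [List.getLast?_cons_cons, List.getLast?_singleton, Option.some.injEq] at hq
    subst hp hq
    refine (Cell.hasArc_carrier (List.isChain_cons_cons.1 hs).1).mono fun z hz => ?_
    exact ⟨(a, b), by simp [polyCells], hz⟩
  | a :: b :: c :: l, p, q, hp, hq, _, hs, hd, hB => by
    simp only [List.head?_cons, Option.some.injEq] at hp
    subst hp
    rw [polyCells, List.pairwise_cons, List.pairwise_cons] at hd
    simp only [polyCells, List.mem_cons, forall_eq_or_imp] at hB
    obtain ⟨hs1, hs2⟩ := List.isChain_cons_cons.1 hs
    have ih := hasArc_region (b :: c :: l) b q rfl (by simpa using hq) (by simp) hs2 hd.2.2 hB.2.2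
    have hab := Cell.hasArc_carrier hs1
    have h1 : gridPoint b ∉ Cell.carrier (a, b) := fun h =>
      Set.disjoint_left.1 (Cell.disjoint_of_apartMod (hd.1 (b, b) (by simp)) hB.1 hB.2.1) h
        (by rw [Cell.carrier_self]; rfl)
    have h2 : gridPoint b ∉ region (polyCells (b :: c :: l)) := fun ⟨P, hP, h⟩ =>
      Set.disjoint_left.1 (Cell.disjoint_of_apartMod (hd.2.1 P hP) hB.2.1 (hB.2.2 P hP))
        (by rw [Cell.carrier_self]; rfl) h
    have h3 : Disjoint (Cell.carrier (a, b)) (region (polyCells (b :: c :: l))) := by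
      rw [Set.disjoint_left]
      rintro z hz ⟨P, hP, h⟩
      exact Set.disjoint_left.1
        (Cell.disjoint_of_apartMod (hd.1 P (List.mem_cons_of_mem _ hP)) hB.1 (hB.2.2 P hP)) hz h
    refine (hab.trans ih h1 h2 h3).mono ?_
    rintro z ((hz | hz) | ⟨P, hP, hz⟩)
    · exact ⟨(a, b), by simp [polyCells], hz⟩
    · exact ⟨(b, b), by simp [polyCells], by rwa [Cell.carrier_self]⟩
    · exact ⟨P, by simp [polyCells, hP], hz⟩

/-- The list of points and the list of polygonal lines form a drawing on the torus: the points and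
the interiors of the lines are pairwise disjoint, and every line is simple. -/
def IsDrawing (pts : List (ℕ × ℕ)) (arcs : List (List (ℕ × ℕ))) : Prop :=
  (pts.map (fun p => [(p, p)]) ++ arcs.map polyCells).Pairwise RegionsApart ∧
    (∀ p ∈ pts, Cell.InBox (p, p)) ∧
    ∀ l ∈ arcs, l.IsChain Cell.IsShort ∧ ((polyCells l).Pairwise fun P Q => Cell.apartMod P Q) ∧
      ∀ P ∈ polyCells l, Cell.InBox P

instance (pts : List (ℕ × ℕ)) (arcs : List (List (ℕ × ℕ))) : Decidable (IsDrawing pts arcs) :=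
  inferInstanceAs (Decidable (_ ∧ _ ∧ _))

/-- The points agree in the torus. -/
def Congruent (p q : ℕ × ℕ) : Prop := p.1 % 10 = q.1 % 10 ∧ p.2 % 10 = q.2 % 10

instance : DecidableRel Congruent := fun _ _ => inferInstanceAs (Decidable (_ ∧ _))

theorem Congruent.gridPoint_eq {p q : ℕ × ℕ} (h : Congruent p q) : gridPoint p = gridPoint q :=
  gridPoint_eq_of_mod_eq h.1 h.2

/-- The polygonal line `l` joins, in the torus, the points `p` and `q`. -/
def Joins (l : List (ℕ × ℕ)) (p q : ℕ × ℕ) : Prop :=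
  2 ≤ l.length ∧
    ((Congruent (l.headD 0) p ∧ Congruent (l.getLastD 0) q) ∨
      (Congruent (l.headD 0) q ∧ Congruent (l.getLastD 0) p))

instance (l : List (ℕ × ℕ)) (p q : ℕ × ℕ) : Decidable (Joins l p q) :=
  inferInstanceAs (Decidable (_ ∧ _))

theorem Joins.symm {l : List (ℕ × ℕ)} {p q : ℕ × ℕ} (h : Joins l p q) : Joins l q p :=
  ⟨h.1, h.2.symm⟩

theorem pairwise_getElem? {α : Type*} {R : α → α → Prop} {L : List α} (h : L.Pairwise R)
    {i j : ℕ} {a b : α} (hi : L[i]? = some a) (hj : L[j]? = some b) (hij : i ≠ j) :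
    R a b ∨ R b a := by
  obtain ⟨hi', rfl⟩ := List.getElem?_eq_some_iff.1 hi
  obtain ⟨hj', rfl⟩ := List.getElem?_eq_some_iff.1 hj
  rcases hij.lt_or_gt with h' | h'
  · exact .inl (List.pairwise_iff_getElem.1 h i j hi' hj' h')
  · exact .inr (List.pairwise_iff_getElem.1 h j i hj' hi' h')

/-- A multigraph is toroidal if its vertices and edges can be mapped injectively to the points and
the lines of a drawing, in such a way that incidence is respected. -/
theorem toroidal_of_isDrawing {α β : Type*} {G : Graph α β} {pts : List (ℕ × ℕ)}
    {arcs : List (List (ℕ × ℕ))} (hD : IsDrawing pts arcs) (φ : α → ℕ) (ψ : β → ℕ)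
    (hφ : φ.Injective) (hφ' : ∀ x, φ x < pts.length)
    (hψ : ∀ e ∈ E(G), ∀ f ∈ E(G), ψ e = ψ f → e = f)
    (hlink : ∀ e x y, G.IsLink e x y →
      ∃ l, arcs[ψ e]? = some l ∧ Joins l (pts.getD (φ x) 0) (pts.getD (φ y) 0)) :
    Toroidal G := by
  obtain ⟨hpair, hpts, harcs⟩ := hD
  rw [List.pairwise_append, List.pairwise_map, List.pairwise_map] at hpair
  obtain ⟨hpp, haa, hpa⟩ := hpair
  have hget : ∀ x, pts[φ x]? = some (pts.getD (φ x) 0) := fun x => by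
    rw [List.getElem?_eq_getElem (hφ' x), List.getD_eq_getElem _ _ (hφ' x)]
  have hmem : ∀ x, pts.getD (φ x) 0 ∈ pts := fun x => List.mem_of_getElem? (hget x)
  have hbox : ∀ p ∈ pts, ∀ P ∈ [((p, p) : Cell)], Cell.InBox P := fun p hp P hP => by
    rw [List.mem_singleton.1 hP]
    exact hpts p hp
  have hreg : ∀ p : ℕ × ℕ, gridPoint p ∈ region [(p, p)] := fun p =>
    ⟨(p, p), List.mem_singleton.2 rfl, by rw [Cell.carrier_self]; rfl⟩
  have hex : ∀ e ∈ E(G), ∃ l, arcs[ψ e]? = some l ∧ ∃ f : C(unitInterval, Torus),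
      (f 0 = gridPoint (l.headD 0) ∧ f 1 = gridPoint (l.getLastD 0)) ∧
      InjOn f (Ioo 0 1) ∧ ∀ t ∈ Ioo (0 : unitInterval) 1, f t ∈ region (polyCells l) := by
    intro e he
    obtain ⟨x, y, hxy⟩ := Graph.exists_isLink_of_mem_edgeSet he
    obtain ⟨l, hl, hJ⟩ := hlink e x y hxy
    obtain ⟨h1, h2, h3⟩ := harcs l (List.mem_of_getElem? hl)
    have hne : l ≠ [] := by
      rintro rfl
      simpa using hJ.1
    obtain ⟨f, f0, f1, hf⟩ := hasArc_region l (l.headD 0) (l.getLastD 0)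
      (by cases l <;> [exact absurd rfl hne; rfl]) (by cases l <;> [exact absurd rfl hne; rfl])
      hJ.1 h1 h2 h3
    exact ⟨l, hl, f, ⟨f0, f1⟩, hf⟩
  choose! l hl f hends hinj hmemf using hex
  refine ⟨⟨fun x => gridPoint (pts.getD (φ x) 0), f, ?_, ?_, hinj, ?_, ?_⟩⟩
  · intro x _ y _ hxy
    change gridPoint _ = gridPoint _ at hxy
    by_contra hne
    have := pairwise_getElem? hpp (hget x) (hget y) (fun h => hne (hφ h))
    rcases this with h | h
    · exact Set.disjoint_left.1 (h.disjoint (hbox _ (hmem x)) (hbox _ (hmem y))) (hreg _)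
        (by rw [hxy]; exact hreg _)
    · exact Set.disjoint_left.1 (h.disjoint (hbox _ (hmem y)) (hbox _ (hmem x))) (hreg _)
        (by rw [← hxy]; exact hreg _)
  · intro e x y hxy
    obtain ⟨l', hl', hJ⟩ := hlink e x y hxy
    have he := hxy.edge_mem
    obtain rfl : l e = l' := Option.some.inj ((hl e he).symm.trans hl')
    rw [(hends e he).1, (hends e he).2]
    exact hJ.2.imp (fun h => ⟨h.1.gridPoint_eq, h.2.gridPoint_eq⟩)
      (fun h => ⟨h.1.gridPoint_eq, h.2.gridPoint_eq⟩)
  · intro e he t ht x _ h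
    have hle := List.mem_of_getElem? (hl e he)
    have := hpa _ (List.mem_map_of_mem (hmem x)) _ (List.mem_map_of_mem hle)
    exact Set.disjoint_left.1 (this.disjoint (hbox _ (hmem x)) (harcs _ hle).2.2) (hreg _)
      (h ▸ hmemf e he t ht)
  · intro e he e' he' hne s hs t ht h
    have hbe := (harcs _ (List.mem_of_getElem? (hl e he))).2.2
    have hbe' := (harcs _ (List.mem_of_getElem? (hl e' he'))).2.2
    have h1 := hmemf e he s hs
    have h2 := hmemf e' he' t ht
    rw [← h] at h2
    rcases pairwise_getElem? haa (hl e he) (hl e' he') (fun h => hne (hψ e he e' he' h)) with h | h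
    · exact Set.disjoint_left.1 (h.disjoint hbe hbe') h1 h2
    · exact Set.disjoint_left.1 (h.disjoint hbe' hbe) h2 h1

/-- Toroidality is inherited along injective maps of vertices and edges that respect incidence. -/
theorem Toroidal.of_map {α β α' β' : Type*} {G : Graph α β} {H : Graph α' β'} (hH : Toroidal H)
    (φ : α → α') (ψ : β → β') (hφ : φ.Injective)
    (hψ : ∀ e ∈ E(G), ∀ f ∈ E(G), ψ e = ψ f → e = f)
    (hlink : ∀ e x y, G.IsLink e x y → H.IsLink (ψ e) (φ x) (φ y))
    (hV : ∀ x ∈ V(G), φ x ∈ V(H)) : Toroidal G := by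
  obtain ⟨D⟩ := hH
  have hE : ∀ e ∈ E(G), ψ e ∈ E(H) := fun e he => by
    obtain ⟨x, y, h⟩ := Graph.exists_isLink_of_mem_edgeSet he
    exact (hlink e x y h).edge_mem
  exact ⟨⟨fun x => D.vert (φ x), fun e => D.arc (ψ e),
    fun x hx y hy h => hφ (D.vert_injOn (hV x hx) (hV y hy) h),
    fun e x y h => D.arc_ends _ _ _ (hlink e x y h),
    fun e he => D.arc_injOn _ (hE e he),
    fun e he t ht x hx => D.arc_ne_vert _ (hE e he) t ht _ (hV x hx),
    fun e he f hf hne => D.arc_ne_arc _ (hE e he) _ (hE f hf) fun h => hne (hψ e he f hf h)⟩⟩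

/-! ### Symmetries of the choice of an edge -/

namespace EdgeChoice

variable {V W : Type*} {G : SimpleGraph V} {H : SimpleGraph W}

/-- Transport of a choice of an edge along an isomorphism of graphs. -/
def map (σ : G ≃g H) : EdgeChoice G → EdgeChoice H
  | pendant x y h => pendant (σ x) (σ y) (σ.map_adj_iff.2 h)
  | same x y h => same (σ x) (σ y) (σ.map_adj_iff.2 h)
  | across x₁ y₁ x₂ y₂ h₁ h₂ hne => across (σ x₁) (σ y₁) (σ x₂) (σ y₂) (σ.map_adj_iff.2 h₁)
      (σ.map_adj_iff.2 h₂) (fun h => hne (Sym2.map.injective σ.injective (by simpa using h)))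

theorem attached_map (σ : G ≃g H) (e : EdgeChoice G) :
    (e.map σ).attached = Sym2.map σ '' e.attached := by
  cases e <;> simp [map, attached, image_insert_eq]

theorem newEdges_map (σ : G ≃g H) (e : EdgeChoice G) :
    (e.map σ).newEdges = e.newEdges.map (Sym2.map (Sum.map σ id)) := by
  cases e <;> simp [map, newEdges]

theorem toroidal_of_map (σ : G ≃g H) {e : EdgeChoice G} (h : Toroidal (addEdge H (e.map σ))) :
    Toroidal (addEdge G e) := by
  refine h.of_map (Sum.map σ id) (Sum.map (Sym2.map σ) id)
    (Sum.map_injective.2 ⟨σ.injective, Function.injective_id⟩)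
    (fun a _ b _ hab => Sum.map_injective.2
      ⟨Sym2.map.injective σ.injective, Function.injective_id⟩ hab) ?_ (fun _ _ => mem_univ _)
  rintro (f | i) a b h
  · obtain ⟨h1, h2, h3⟩ := h
    refine ⟨?_, ?_, ?_⟩
    · induction f with | _ x y => exact σ.map_adj_iff.2 h1
    · rw [attached_map]
      rintro ⟨g, hg, hgf⟩
      exact h2 (Sym2.map.injective σ.injective hgf ▸ hg)
    · have := congrArg (Sym2.map (Sum.map σ id)) h3
      rw [Sym2.map_map] at this
      rw [Sym2.map_map]
      exact this
  · change e.newEdges[i]? = _ at h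
    change (e.map σ).newEdges[i]? = _
    rw [newEdges_map, List.getElem?_map, h]
    rfl

/-- Reversing an attached edge, or exchanging the two, only renames `u`, `v` (by `τ`) and permutes
the positions in `newEdges` (by `π`). -/
theorem toroidal_of_relabel {e e' : EdgeChoice G} (τ : Equiv.Perm (Fin 2)) (π : Equiv.Perm ℕ)
    (hatt : e'.attached = e.attached)
    (hnew : ∀ i, e'.newEdges[π i]? = e.newEdges[i]?.map (Sym2.map (Sum.map id τ)))
    (h : Toroidal (addEdge G e')) : Toroidal (addEdge G e) := by
  refine h.of_map (Sum.map id τ) (Sum.map id π)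
    (Sum.map_injective.2 ⟨Function.injective_id, τ.injective⟩)
    (fun a _ b _ hab => Sum.map_injective.2 ⟨Function.injective_id, π.injective⟩ hab) ?_
    (fun _ _ => mem_univ _)
  rintro (f | i) a b h
  · obtain ⟨h1, h2, h3⟩ := h
    refine ⟨h1, hatt ▸ h2, ?_⟩
    have := congrArg (Sym2.map (Sum.map id τ)) h3
    rwa [Sym2.map_map] at this
  · change e.newEdges[i]? = _ at h
    change e'.newEdges[π i]? = _
    rw [hnew, h]
    rfl

theorem toroidal_of_pendant_symm {x y : V} {h : G.Adj x y}
    (hT : Toroidal (addEdge G (pendant y x h.symm))) : Toroidal (addEdge G (pendant x y h)) := by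
  refine toroidal_of_relabel 1 (Equiv.swap 0 1) (by simp [attached, Sym2.eq_swap (a := x)]) ?_ hT
  rintro (_ | _ | _ | _ | i) <;> simp [newEdges, Equiv.swap_apply_def, Sym2.eq_swap]

theorem toroidal_of_same_symm {x y : V} {h : G.Adj x y}
    (hT : Toroidal (addEdge G (same y x h.symm))) : Toroidal (addEdge G (same x y h)) := by
  refine toroidal_of_relabel (Equiv.swap 0 1) (Equiv.swap 0 2)
    (by simp [attached, Sym2.eq_swap (a := x)]) ?_ hT
  rintro (_ | _ | _ | _ | i) <;> simp [newEdges, Equiv.swap_apply_def, Sym2.eq_swap]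

theorem toroidal_pendant_congr {x y a b : V} {h : G.Adj x y} {k : G.Adj a b}
    (hT : Toroidal (addEdge G (pendant a b k))) (e : s(x, y) = s(a, b)) :
    Toroidal (addEdge G (pendant x y h)) := by
  rcases Sym2.eq_iff.1 e with ⟨rfl, rfl⟩ | ⟨rfl, rfl⟩
  · exact hT
  · exact toroidal_of_pendant_symm hT

theorem toroidal_same_congr {x y a b : V} {h : G.Adj x y} {k : G.Adj a b}
    (hT : Toroidal (addEdge G (same a b k))) (e : s(x, y) = s(a, b)) :
    Toroidal (addEdge G (same x y h)) := by
  rcases Sym2.eq_iff.1 e with ⟨rfl, rfl⟩ | ⟨rfl, rfl⟩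
  · exact hT
  · exact toroidal_of_same_symm hT

theorem toroidal_of_across_symm_left {x₁ y₁ x₂ y₂ : V} {h₁ : G.Adj x₁ y₁} {h₂ : G.Adj x₂ y₂}
    {hne : s(x₁, y₁) ≠ s(x₂, y₂)}
    (hT : Toroidal (addEdge G (across y₁ x₁ x₂ y₂ h₁.symm h₂ (Sym2.eq_swap.trans_ne hne)))) :
    Toroidal (addEdge G (across x₁ y₁ x₂ y₂ h₁ h₂ hne)) := by
  refine toroidal_of_relabel 1 (Equiv.swap 0 1) (by simp [attached, Sym2.eq_swap (a := x₁)]) ?_ hT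
  rintro (_ | _ | _ | _ | _ | i) <;> simp [newEdges, Equiv.swap_apply_def, Sym2.eq_swap]

theorem toroidal_of_across_comm {x₁ y₁ x₂ y₂ : V} {h₁ : G.Adj x₁ y₁} {h₂ : G.Adj x₂ y₂}
    {hne : s(x₁, y₁) ≠ s(x₂, y₂)}
    (hT : Toroidal (addEdge G (across x₂ y₂ x₁ y₁ h₂ h₁ hne.symm))) :
    Toroidal (addEdge G (across x₁ y₁ x₂ y₂ h₁ h₂ hne)) := by
  -- Positions 0, 1 are the halves of the first edge and 2, 3 those of the second; the edge `uv`
  -- stays at position 4.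
  refine toroidal_of_relabel (Equiv.swap 0 1) (Equiv.swap 0 2 * Equiv.swap 1 3)
    (by simp [attached, pair_comm]) ?_ hT
  rintro (_ | _ | _ | _ | _ | i) <;> simp [newEdges, Equiv.swap_apply_def, Sym2.eq_swap]

theorem toroidal_of_across_symm_right {x₁ y₁ x₂ y₂ : V} {h₁ : G.Adj x₁ y₁} {h₂ : G.Adj x₂ y₂}
    {hne : s(x₁, y₁) ≠ s(x₂, y₂)}
    (hT : Toroidal (addEdge G (across x₁ y₁ y₂ x₂ h₁ h₂.symm (hne.trans_eq Sym2.eq_swap)))) :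
    Toroidal (addEdge G (across x₁ y₁ x₂ y₂ h₁ h₂ hne)) :=
  toroidal_of_across_comm (toroidal_of_across_symm_left (toroidal_of_across_comm hT))

/-- The edges to which `e` is attached determine, up to toroidality, the graph obtained by
subdividing two edges. -/
theorem toroidal_across_congr {x₁ y₁ x₂ y₂ a₁ b₁ a₂ b₂ : V} {h₁ : G.Adj x₁ y₁} {h₂ : G.Adj x₂ y₂}
    {hne : s(x₁, y₁) ≠ s(x₂, y₂)} {k₁ : G.Adj a₁ b₁} {k₂ : G.Adj a₂ b₂}
    {kne : s(a₁, b₁) ≠ s(a₂, b₂)} (hT : Toroidal (addEdge G (across a₁ b₁ a₂ b₂ k₁ k₂ kne)))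
    (h : (s(x₁, y₁) = s(a₁, b₁) ∧ s(x₂, y₂) = s(a₂, b₂)) ∨
      (s(x₁, y₁) = s(a₂, b₂) ∧ s(x₂, y₂) = s(a₁, b₁))) :
    Toroidal (addEdge G (across x₁ y₁ x₂ y₂ h₁ h₂ hne)) := by
  have key : ∀ {x₁ y₁ x₂ y₂ : V} {h₁ : G.Adj x₁ y₁} {h₂ : G.Adj x₂ y₂}
      {hne : s(x₁, y₁) ≠ s(x₂, y₂)}, s(x₁, y₁) = s(a₁, b₁) → s(x₂, y₂) = s(a₂, b₂) →
      Toroidal (addEdge G (across x₁ y₁ x₂ y₂ h₁ h₂ hne)) := by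
    intro x₁ y₁ x₂ y₂ h₁ h₂ hne e₁ e₂
    rcases Sym2.eq_iff.1 e₁ with ⟨rfl, rfl⟩ | ⟨rfl, rfl⟩ <;>
    rcases Sym2.eq_iff.1 e₂ with ⟨rfl, rfl⟩ | ⟨rfl, rfl⟩
    · exact hT
    · exact toroidal_of_across_symm_right hT
    · exact toroidal_of_across_symm_left hT
    · exact toroidal_of_across_symm_left (toroidal_of_across_symm_right hT)
  rcases h with ⟨e₁, e₂⟩ | ⟨e₁, e₂⟩
  · exact key e₁ e₂
  · exact toroidal_of_across_comm (key e₂ e₁)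

end EdgeChoice

/-! ### A drawing of `F₁₃` on the torus -/

/-- The position of a vertex of `F₁₃ ∪ e` in the list of points of a drawing. -/
def vertexIndex : F13Vertex ⊕ Fin 2 → ℕ
  | .inl (.inl k) => k
  | .inl (.inr i) => 3 + i
  | .inr u => 12 + u

theorem vertexIndex_injective : Function.Injective vertexIndex := by decide

/-- The points `A`, `B`, `C`, `9`, `1`, …, `8`. -/
def f13Points : List (ℕ × ℕ) :=
  [(5, 5), (1, 4), (6, 9), (8, 7), (7, 5), (8, 4), (6, 2), (5, 3), (3, 2), (4, 9), (3, 7), (1, 6)]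

/-- The edges of `F₁₃`, and segments which represent them. -/
def f13Segments : List ((F13Vertex × F13Vertex) × Cell) :=
  -- A coordinate above nine marks a translate by the period ten: the segment crosses a side of the
  -- fundamental square.
  [((r 1, r 2), (7, 5), (8, 4)), ((r 2, r 3), (8, 4), (6, 2)), ((r 3, r 4), (6, 2), (5, 3)),
    ((r 4, r 5), (5, 3), (3, 2)), ((r 5, r 6), (3, 12), (4, 9)), ((r 6, r 7), (4, 9), (3, 7)),
    ((r 7, r 8), (3, 7), (1, 6)), ((r 8, r 9), (11, 6), (8, 7)), ((r 9, r 1), (8, 7), (7, 5)),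
    ((A, r 1), (5, 5), (7, 5)), ((A, r 4), (5, 5), (5, 3)), ((A, r 7), (5, 5), (3, 7)),
    ((B, r 2), (11, 4), (8, 4)), ((B, r 5), (1, 4), (3, 2)), ((B, r 8), (1, 4), (1, 6)),
    ((C, r 3), (6, 9), (6, 12)), ((C, r 6), (6, 9), (4, 9)), ((C, r 9), (6, 9), (8, 7))]

/-- The position of an edge in the list `f13Segments`. -/
def edgeIndex (f : Sym2 F13Vertex) : ℕ := (f13Segments.map fun S => s(S.1.1, S.1.2)).idxOf f

/-- The segments which represent the edges of `F₁₃`, with the exception of some edges, which are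
represented by empty lines. -/
def f13Arcs (del : List ℕ) : List (List (ℕ × ℕ)) :=
  f13Segments.mapIdx fun i S => if i ∈ del then [] else [S.2.1, S.2.2]

theorem mem_map_segments {f : Sym2 F13Vertex} (hf : f ∈ F13.edgeSet) :
    f ∈ f13Segments.map fun S => s(S.1.1, S.1.2) := by
  have h : ∀ f ∈ f13Edges, f ∈ f13Segments.map fun S => s(S.1.1, S.1.2) := by decide +kernel
  induction f with | _ x y => exact h _ hf

theorem edgeIndex_inj {f g : Sym2 F13Vertex} (hf : f ∈ F13.edgeSet) (h : edgeIndex f = edgeIndex g) :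
    f = g :=
  (List.idxOf_inj (mem_map_segments hf)).1 h

theorem joins_f13Segments : ∀ S ∈ f13Segments, ∀ u v : ℕ × ℕ, Joins [S.2.1, S.2.2]
    ((f13Points ++ [u, v]).getD (vertexIndex (.inl S.1.1)) 0)
    ((f13Points ++ [u, v]).getD (vertexIndex (.inl S.1.2)) 0) := by
  have h : ∀ S ∈ f13Segments, vertexIndex (.inl S.1.1) < 12 ∧ vertexIndex (.inl S.1.2) < 12 ∧
      Joins [S.2.1, S.2.2] (f13Points.getD (vertexIndex (.inl S.1.1)) 0)
        (f13Points.getD (vertexIndex (.inl S.1.2)) 0) := by decide +kernel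
  intro S hS u v
  obtain ⟨h1, h2, h3⟩ := h S hS
  rwa [List.getD_append _ _ _ _ h1, List.getD_append _ _ _ _ h2]

/-- The polygonal line `l` joins the points which represent the vertices `a` and `b`. -/
def JoinsEnds (pts l : List (ℕ × ℕ)) (a b : F13Vertex ⊕ Fin 2) : Prop :=
  Joins l (pts.getD (vertexIndex a) 0) (pts.getD (vertexIndex b) 0)

instance (pts l : List (ℕ × ℕ)) (a b : F13Vertex ⊕ Fin 2) : Decidable (JoinsEnds pts l a b) :=
  inferInstanceAs (Decidable (Joins _ _ _))

/-- The graph `F₁₃ ∪ e` is toroidal if the drawing of `F₁₃` without the subdivided edges extends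
to a drawing of `F₁₃ ∪ e`. -/
theorem toroidal_addEdge_of_isDrawing {e : EdgeChoice F13} {u v : ℕ × ℕ} {del : List ℕ}
    {new : List (List (ℕ × ℕ))} (hD : IsDrawing (f13Points ++ [u, v]) (f13Arcs del ++ new))
    (hdel : ∀ f ∈ F13.edgeSet, edgeIndex f ∈ del → f ∈ e.attached)
    (hnew : List.Forall₂ (fun z l => ∃ a b, z = s(a, b) ∧ JoinsEnds (f13Points ++ [u, v]) l a b)
      e.newEdges new) : Toroidal (addEdge F13 e) := by
  have hlen : ∀ del, (f13Arcs del).length = 18 := fun del => by simp [f13Arcs, f13Segments]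
  have hidx : ∀ f ∈ F13.edgeSet, edgeIndex f < 18 := fun f hf => by
    have := List.idxOf_lt_length_of_mem (mem_map_segments hf)
    rwa [List.length_map] at this
  -- Deleted segments remain as empty lines, so the old edges keep their positions below 18 and the
  -- new ones start at 18.
  refine toroidal_of_isDrawing hD vertexIndex (Sum.elim edgeIndex (18 + ·)) vertexIndex_injective
    ?_ ?_ ?_
  · have : ∀ x, vertexIndex x < 14 := by decide
    intro x
    simpa [f13Points] using this x
  · rintro (f | i) hf (g | j) hg h
    · obtain ⟨_, _, hf⟩ := Graph.exists_isLink_of_mem_edgeSet hf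
      exact congrArg Sum.inl (edgeIndex_inj hf.1 h)
    · obtain ⟨_, _, hf⟩ := Graph.exists_isLink_of_mem_edgeSet hf
      have := hidx f hf.1
      simp only [Sum.elim_inl, Sum.elim_inr] at h
      omega
    · obtain ⟨_, _, hg⟩ := Graph.exists_isLink_of_mem_edgeSet hg
      have := hidx g hg.1
      simp only [Sum.elim_inl, Sum.elim_inr] at h
      omega
    · simp only [Sum.elim_inr] at h
      exact congrArg Sum.inr (by omega)
  · rintro (f | i) a b h
    · obtain ⟨hf, hf', hab⟩ := h
      have hi : edgeIndex f < f13Segments.length := hidx f hf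
      have hfS : s((f13Segments[edgeIndex f]).1.1, (f13Segments[edgeIndex f]).1.2) = f := by
        have := List.getElem_idxOf (List.idxOf_lt_length_of_mem (mem_map_segments hf))
        rwa [List.getElem_map] at this
      have hJ := joins_f13Segments _ (List.getElem_mem hi) u v
      refine ⟨[(f13Segments[edgeIndex f]).2.1, (f13Segments[edgeIndex f]).2.2], ?_, ?_⟩
      · rw [Sum.elim_inl, List.getElem?_append_left (by rw [hlen]; exact hidx f hf), f13Arcs,
          List.getElem?_mapIdx, List.getElem?_eq_getElem hi, Option.map_some,
          if_neg fun h => hf' (hdel f hf h)]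
      · rw [← hfS, Sym2.map_mk] at hab
        rcases Sym2.eq_iff.1 hab with ⟨h1, h2⟩ | ⟨h1, h2⟩
        · rwa [h1, h2] at hJ
        · rw [h1, h2] at hJ
          exact hJ.symm
    · change e.newEdges[i]? = _ at h
      obtain ⟨hi, hi'⟩ := List.getElem?_eq_some_iff.1 h
      have hi2 : i < new.length := hnew.length_eq ▸ hi
      obtain ⟨a', b', hab, hJ⟩ := hnew.get hi hi2
      refine ⟨new[i], ?_, ?_⟩
      · simp [hlen, hi2]
      · simp only [List.get_eq_getElem, hi'] at hab hJ
        rcases Sym2.eq_iff.1 hab with ⟨rfl, rfl⟩ | ⟨rfl, rfl⟩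
        · exact hJ
        · exact hJ.symm

/-! ### Automorphisms of `F₁₃` -/

/-- The rotation of the nine-cycle by `j`, preceded by a reflection if `b` holds, and its effect on
the vertices `A`, `B`, `C`. -/
def dihedral (b : Bool) (j : Fin 9) : F13Vertex → F13Vertex
  -- Letter `k` is adjacent to the labels congruent to `k + 1` modulo three, so `i ↦ -i` induces `k
  -- ↦ 1 - k`.
  | .inl k => .inl ((if b then 1 - k else k) + Fin.ofNat 3 j)
  | .inr i => .inr ((if b then -i else i) + j)

theorem dihedral_injective : ∀ b j, Function.Injective (dihedral b j) := by decide +kernel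

theorem map_dihedral_mem : ∀ b j, ∀ f ∈ f13Edges, Sym2.map (dihedral b j) f ∈ f13Edges := by
  decide +kernel

/-- An injection of the finite edge set into itself is onto, so non-edges cannot be mapped to edges.
-/
theorem dihedral_adj (b : Bool) (j : Fin 9) (x y : F13Vertex) :
    F13.Adj (dihedral b j x) (dihedral b j y) ↔ F13.Adj x y := by
  have hinj := Sym2.map.injective (dihedral_injective b j)
  have himage : f13Edges.image (Sym2.map (dihedral b j)) = f13Edges :=
    Finset.eq_of_subset_of_card_le (Finset.image_subset_iff.2 (map_dihedral_mem b j))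
      (Finset.card_image_of_injective _ hinj).ge
  have hAdj : ∀ x y, F13.Adj x y ↔ s(x, y) ∈ f13Edges := fun _ _ => Iff.rfl
  rw [hAdj, hAdj, ← hinj.mem_finset_image (a := s(x, y)), himage, Sym2.map_mk]

/-- The elements of the dihedral group of order eighteen, as automorphisms of `F₁₃`. -/
noncomputable def dihedralIso (b : Bool) (j : Fin 9) : F13 ≃g F13 where
  toEquiv := Equiv.ofBijective _ (Finite.injective_iff_bijective.1 (dihedral_injective b j))
  map_rel_iff' := dihedral_adj b j _ _

/-! ### Drawings of the graphs `F₁₃ ∪ e` -/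

/-- For every orbit of pairs of edges of `F₁₃`, the indices of two edges in this orbit which are
incident with a common face of the drawing, the points which subdivide them, and the ends of a
segment which joins these points. -/
def acrossTable : List ((ℕ × ℕ) × (ℕ × ℕ) × (ℕ × ℕ) × Cell) :=
  [((9, 10), (6, 5), (5, 4), (6, 5), (5, 4)), ((2, 9), (5, 2), (6, 5), (5, 2), (6, 5)),
    ((1, 9), (7, 3), (6, 5), (7, 3), (6, 5)), ((0, 9), (7, 4), (6, 5), (7, 4), (6, 5)),
    ((1, 2), (7, 3), (5, 2), (7, 3), (5, 2)), ((0, 2), (7, 4), (5, 2), (7, 4), (5, 2)),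
    ((6, 10), (2, 6), (5, 4), (2, 6), (5, 4)), ((10, 14), (5, 4), (1, 5), (5, 4), (1, 5)),
    ((10, 13), (5, 4), (2, 3), (5, 4), (2, 3)), ((11, 13), (4, 6), (2, 3), (4, 6), (2, 3)),
    ((3, 6), (4, 2), (2, 6), (4, 2), (2, 6)), ((5, 12), (3, 8), (9, 4), (13, 8), (9, 14)),
    ((1, 6), (7, 3), (2, 6), (7, 13), (12, 6))]

/-- The entry of `f13Segments` with a given index. -/
def segment (a : ℕ) : (F13Vertex × F13Vertex) × Cell := f13Segments.getD a ((A, A), 0)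

/-- The lines which represent the new edges in a drawing given by `acrossTable`. -/
def acrossArcs (T : (ℕ × ℕ) × (ℕ × ℕ) × (ℕ × ℕ) × Cell) : List (List (ℕ × ℕ)) :=
  [[(segment T.1.1).2.1, T.2.1], [T.2.1, (segment T.1.1).2.2],
    [(segment T.1.2).2.1, T.2.2.1], [T.2.2.1, (segment T.1.2).2.2],
    [T.2.2.2.1, T.2.2.2.2]]

/-- The subdividing points are grid points that need not lie on the deleted segments; the two halves
of an edge may therefore form a bend. -/
theorem isDrawing_acrossTable : ∀ T ∈ acrossTable,
    IsDrawing (f13Points ++ [T.2.1, T.2.2.1]) (f13Arcs [T.1.1, T.1.2] ++ acrossArcs T) := by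
  decide +kernel

theorem joinsEnds_acrossTable : ∀ T ∈ acrossTable,
    edgeIndex s((segment T.1.1).1.1, (segment T.1.1).1.2) = T.1.1 ∧
    edgeIndex s((segment T.1.2).1.1, (segment T.1.2).1.2) = T.1.2 ∧
    List.Forall₂ (fun z l => JoinsEnds (f13Points ++ [T.2.1, T.2.2.1]) l z.1 z.2)
      [(.inl (segment T.1.1).1.1, .inr 0), (.inr 0, .inl (segment T.1.1).1.2),
        (.inl (segment T.1.2).1.1, .inr 1), (.inr 1, .inl (segment T.1.2).1.2), (.inr 0, .inr 1)]
      (acrossArcs T) := by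
  simp only [acrossArcs, List.forall₂_cons, List.forall₂_nil_left_iff, and_true]
  decide +kernel

theorem toroidal_across_segment {T : (ℕ × ℕ) × (ℕ × ℕ) × (ℕ × ℕ) × Cell} (hT : T ∈ acrossTable)
    (h₁ : F13.Adj (segment T.1.1).1.1 (segment T.1.1).1.2)
    (h₂ : F13.Adj (segment T.1.2).1.1 (segment T.1.2).1.2)
    (hne : s((segment T.1.1).1.1, (segment T.1.1).1.2) ≠
      s((segment T.1.2).1.1, (segment T.1.2).1.2)) :
    Toroidal (addEdge F13 (.across _ _ _ _ h₁ h₂ hne)) := by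
  obtain ⟨hi₁, hi₂, hJ⟩ := joinsEnds_acrossTable T hT
  refine toroidal_addEdge_of_isDrawing (isDrawing_acrossTable T hT) ?_ ?_
  · intro f hf h
    simp only [List.mem_cons, List.not_mem_nil, or_false] at h
    rcases h with h | h
    · exact .inl (edgeIndex_inj hf (h.trans hi₁.symm))
    · exact .inr (edgeIndex_inj hf (h.trans hi₂.symm))
  · simp only [acrossArcs, List.forall₂_cons, List.forall₂_nil_left_iff, and_true] at hJ
    obtain ⟨j₁, j₂, j₃, j₄, j₅⟩ := hJ
    exact .cons ⟨_, _, rfl, j₁⟩ (.cons ⟨_, _, rfl, j₂⟩ (.cons ⟨_, _, rfl, j₃⟩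
      (.cons ⟨_, _, rfl, j₄⟩ (.cons ⟨_, _, rfl, j₅⟩ .nil))))

/-! ### Reduction to representatives of the orbits -/

theorem exists_dihedral_edge : ∀ f ∈ f13Edges, ∃ b j,
    Sym2.map (dihedral b j) f = s(r 1, r 2) ∨ Sym2.map (dihedral b j) f = s(A, r 1) := by
  decide +kernel

theorem exists_acrossTable : ∀ f ∈ [s(r 1, r 2), s(A, r 1)], ∀ g ∈ f13Edges, f ≠ g →
    ∃ T ∈ acrossTable, ∃ b j,
      (Sym2.map (dihedral b j) f = s((segment T.1.1).1.1, (segment T.1.1).1.2) ∧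
        Sym2.map (dihedral b j) g = s((segment T.1.2).1.1, (segment T.1.2).1.2)) ∨
      (Sym2.map (dihedral b j) f = s((segment T.1.2).1.1, (segment T.1.2).1.2) ∧
        Sym2.map (dihedral b j) g = s((segment T.1.1).1.1, (segment T.1.1).1.2)) := by
  decide +kernel

theorem segment_adj_ne : ∀ T ∈ acrossTable,
    F13.Adj (segment T.1.1).1.1 (segment T.1.1).1.2 ∧
    F13.Adj (segment T.1.2).1.1 (segment T.1.2).1.2 ∧
    s((segment T.1.1).1.1, (segment T.1.1).1.2) ≠
      s((segment T.1.2).1.1, (segment T.1.2).1.2) := by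
  decide +kernel

/-- The loop is drawn as a small triangle based at `v` inside a face; 0 is the index of the edge
`12`. -/
theorem toroidal_pendant_ring (h : F13.Adj (r 1) (r 2)) :
    Toroidal (addEdge F13 (.pendant (r 1) (r 2) h)) := by
  refine toroidal_addEdge_of_isDrawing (u := (7, 4)) (v := (8, 5)) (del := [0])
    (new := [[(7, 5), (7, 4)], [(7, 4), (8, 4)], [(7, 4), (8, 5)],
      [(8, 5), (8, 6), (9, 5), (8, 5)]]) (by decide +kernel) ?_ ?_
  · intro f hf h
    exact edgeIndex_inj hf ((List.mem_singleton.1 h).trans (by decide +kernel))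
  · exact .cons ⟨_, _, rfl, by decide⟩ (.cons ⟨_, _, rfl, by decide⟩ (.cons ⟨_, _, rfl, by decide⟩
      (.cons ⟨_, _, rfl, by decide⟩ .nil)))

theorem toroidal_pendant_spoke (h : F13.Adj A (r 1)) :
    Toroidal (addEdge F13 (.pendant A (r 1) h)) := by
  refine toroidal_addEdge_of_isDrawing (u := (5, 6)) (v := (4, 7)) (del := [9])
    (new := [[(5, 5), (5, 6)], [(5, 6), (7, 5)], [(5, 6), (4, 7)],
      [(4, 7), (4, 8), (5, 7), (4, 7)]]) (by decide +kernel) ?_ ?_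
  · intro f hf h
    exact edgeIndex_inj hf ((List.mem_singleton.1 h).trans (by decide +kernel))
  · exact .cons ⟨_, _, rfl, by decide⟩ (.cons ⟨_, _, rfl, by decide⟩ (.cons ⟨_, _, rfl, by decide⟩
      (.cons ⟨_, _, rfl, by decide⟩ .nil)))

/-- One of the two parallel edges is a segment `uv`, and the other goes round a third corner. -/
theorem toroidal_same_ring (h : F13.Adj (r 1) (r 2)) :
    Toroidal (addEdge F13 (.same (r 1) (r 2) h)) := by
  refine toroidal_addEdge_of_isDrawing (u := (6, 4)) (v := (6, 3)) (del := [0])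
    (new := [[(7, 5), (6, 4)], [(6, 4), (6, 3)], [(6, 3), (8, 4)], [(6, 4), (7, 4), (6, 3)]])
    (by decide +kernel) ?_ ?_
  · intro f hf h
    exact edgeIndex_inj hf ((List.mem_singleton.1 h).trans (by decide +kernel))
  · exact .cons ⟨_, _, rfl, by decide⟩ (.cons ⟨_, _, rfl, by decide⟩ (.cons ⟨_, _, rfl, by decide⟩
      (.cons ⟨_, _, rfl, by decide⟩ .nil)))

theorem toroidal_same_spoke (h : F13.Adj A (r 1)) :
    Toroidal (addEdge F13 (.same A (r 1) h)) := by
  refine toroidal_addEdge_of_isDrawing (u := (5, 6)) (v := (5, 7)) (del := [9])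
    (new := [[(5, 5), (5, 6)], [(5, 6), (5, 7)], [(5, 7), (7, 5)], [(5, 6), (4, 7), (5, 7)]])
    (by decide +kernel) ?_ ?_
  · intro f hf h
    exact edgeIndex_inj hf ((List.mem_singleton.1 h).trans (by decide +kernel))
  · exact .cons ⟨_, _, rfl, by decide⟩ (.cons ⟨_, _, rfl, by decide⟩ (.cons ⟨_, _, rfl, by decide⟩
      (.cons ⟨_, _, rfl, by decide⟩ .nil)))

theorem toroidal_addEdge_F13 (e : EdgeChoice F13) : Toroidal (addEdge F13 e) := by
  have hring : F13.Adj (r 1) (r 2) := by decide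
  have hspoke : F13.Adj A (r 1) := by decide
  cases e with
  | pendant x y h =>
    obtain ⟨b, j, hbj⟩ := exists_dihedral_edge s(x, y) h
    refine EdgeChoice.toroidal_of_map (dihedralIso b j) ?_
    rcases hbj with hbj | hbj
    · exact EdgeChoice.toroidal_pendant_congr (toroidal_pendant_ring hring) hbj
    · exact EdgeChoice.toroidal_pendant_congr (toroidal_pendant_spoke hspoke) hbj
  | same x y h =>
    obtain ⟨b, j, hbj⟩ := exists_dihedral_edge s(x, y) h
    refine EdgeChoice.toroidal_of_map (dihedralIso b j) ?_
    rcases hbj with hbj | hbj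
    · exact EdgeChoice.toroidal_same_congr (toroidal_same_ring hring) hbj
    · exact EdgeChoice.toroidal_same_congr (toroidal_same_spoke hspoke) hbj
  | across x₁ y₁ x₂ y₂ h₁ h₂ hne =>
    obtain ⟨b, j, hbj⟩ := exists_dihedral_edge s(x₁, y₁) h₁
    refine EdgeChoice.toroidal_of_map (dihedralIso b j) ?_
    -- With the first edge already moved to `12` or `A1`, a second symmetry brings the pair to a
    -- pair in the table.
    obtain ⟨T, hT, c, k, hck⟩ := exists_acrossTable _ (by simpa using hbj)
      (Sym2.map (dihedral b j) s(x₂, y₂)) (map_dihedral_mem b j _ h₂)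
      fun h => hne (Sym2.map.injective (dihedral_injective b j) h)
    obtain ⟨k₁, k₂, kne⟩ := segment_adj_ne T hT
    exact EdgeChoice.toroidal_of_map (dihedralIso c k)
      (EdgeChoice.toroidal_across_congr (toroidal_across_segment hT k₁ k₂ kne) hck)

/-! ### Short cycles -/

theorem girth_le_of_hasCycle {α β : Type*} {G : Graph α β} {n : ℕ} (h : HasCycle G n) :
    girth G ≤ n :=
  iInf_le (fun m : {m : ℕ // HasCycle G m} => ((m : ℕ) : ℕ∞)) ⟨n, h⟩

theorem not_hasCycle_of_le_girth {α β : Type*} {G : Graph α β} {m n : ℕ} (h : m ≤ girth G)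
    (hnm : n < m) : ¬ HasCycle G n := fun hn =>
  absurd (Nat.cast_le.1 (h.trans (girth_le_of_hasCycle hn))) (not_le.2 hnm)

namespace EdgeChoice

variable {V : Type*} {G : SimpleGraph V}

theorem hasCycle_pendant (x y : V) (h : G.Adj x y) : HasCycle (addEdge G (pendant x y h)) 1 :=
  ⟨one_pos, fun _ => .inr 1, fun _ => .inr 3, Function.injective_of_subsingleton _,
    Function.injective_of_subsingleton _, fun _ => rfl⟩

theorem hasCycle_same (x y : V) (h : G.Adj x y) : HasCycle (addEdge G (same x y h)) 2 := by
  refine ⟨two_pos, ![.inr 0, .inr 1], ![.inr 1, .inr 3], ?_, ?_, ?_⟩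
  · change Function.Injective (_ : Fin 2 → _)
    intro a b
    fin_cases a <;> fin_cases b <;> simp
  · change Function.Injective (_ : Fin 2 → _)
    intro a b
    fin_cases a <;> fin_cases b <;> simp
  · change ∀ i : Fin 2, _
    intro i
    fin_cases i
    · rfl
    · exact congrArg some Sym2.eq_swap

/-- The triangle is `z`, `u`, `v`. The bounds `i < 2 ≤ j < 4` make its labels `i`, `4`, `j`
distinct. -/
theorem hasCycle_across {x₁ y₁ x₂ y₂ : V} {h₁ : G.Adj x₁ y₁} {h₂ : G.Adj x₂ y₂}
    {hne : s(x₁, y₁) ≠ s(x₂, y₂)} {z : V} (hz₁ : z ∈ s(x₁, y₁)) (hz₂ : z ∈ s(x₂, y₂)) :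
    HasCycle (addEdge G (across x₁ y₁ x₂ y₂ h₁ h₂ hne)) 3 := by
  have hi : ∃ i < 2, (across x₁ y₁ x₂ y₂ h₁ h₂ hne).newEdges[i]? = some s(.inl z, .inr 0) := by
    rcases Sym2.mem_iff.1 hz₁ with rfl | rfl
    · exact ⟨0, by norm_num, rfl⟩
    · exact ⟨1, by norm_num, congrArg some Sym2.eq_swap⟩
  have hj : ∃ j, 2 ≤ j ∧ j < 4 ∧
      (across x₁ y₁ x₂ y₂ h₁ h₂ hne).newEdges[j]? = some s(.inr 1, .inl z) := by
    rcases Sym2.mem_iff.1 hz₂ with rfl | rfl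
    · exact ⟨2, by norm_num, by norm_num, congrArg some Sym2.eq_swap⟩
    · exact ⟨3, by norm_num, by norm_num, rfl⟩
  obtain ⟨i, hi, hi'⟩ := hi
  obtain ⟨j, hj, hj', hj''⟩ := hj
  refine ⟨three_pos, ![.inl z, .inr 0, .inr 1], ![.inr i, .inr 4, .inr j], ?_, ?_, ?_⟩
  · change Function.Injective (_ : Fin 3 → _)
    intro a b
    fin_cases a <;> fin_cases b <;> simp
  · change Function.Injective (_ : Fin 3 → _)
    intro a b
    fin_cases a <;> fin_cases b <;> simp <;> omega
  · change ∀ i : Fin 3, _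
    intro a
    fin_cases a
    · exact hi'
    · rfl
    · exact hj''

theorem across_link_cases {x₁ y₁ x₂ y₂ : V} {h₁ : G.Adj x₁ y₁} {h₂ : G.Adj x₂ y₂}
    {hne : s(x₁, y₁) ≠ s(x₂, y₂)} {c : Sym2 V ⊕ ℕ} {a b : V ⊕ Fin 2}
    (h : (across x₁ y₁ x₂ y₂ h₁ h₂ hne).Link c a b) :
    (∃ x y, a = .inl x ∧ b = .inl y ∧ G.Adj x y ∧ s(x, y) ≠ s(x₁, y₁) ∧ s(x, y) ≠ s(x₂, y₂) ∧
      c = .inl s(x, y)) ∨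
    (s(a, b) = s(.inl x₁, .inr 0) ∧ c = .inr 0) ∨ (s(a, b) = s(.inl y₁, .inr 0) ∧ c = .inr 1) ∨
    (s(a, b) = s(.inl x₂, .inr 1) ∧ c = .inr 2) ∨ (s(a, b) = s(.inl y₂, .inr 1) ∧ c = .inr 3) ∨
    (s(a, b) = s(.inr 0, .inr 1) ∧ c = .inr 4) := by
  rcases c with f | i
  · obtain ⟨hf, hf', hab⟩ := h
    left
    induction f with | _ x y => ?_
    have hatt : s(x, y) ≠ s(x₁, y₁) ∧ s(x, y) ≠ s(x₂, y₂) := not_or.1 hf'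
    rcases Sym2.eq_iff.1 hab with ⟨rfl, rfl⟩ | ⟨rfl, rfl⟩
    · exact ⟨x, y, rfl, rfl, hf, hatt.1, hatt.2, rfl⟩
    · refine ⟨y, x, rfl, rfl, hf.symm, ?_, ?_, congrArg Sum.inl Sym2.eq_swap⟩
      · exact Sym2.eq_swap.trans_ne hatt.1
      · exact Sym2.eq_swap.trans_ne hatt.2
  · right
    change [_, _, _, _, _][i]? = some _ at h
    rcases i with _ | _ | _ | _ | _ | i
    · exact .inl ⟨(Option.some.inj h).symm, rfl⟩
    · exact .inr (.inl ⟨(Option.some.inj h).symm.trans Sym2.eq_swap, rfl⟩)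
    · exact .inr (.inr (.inl ⟨(Option.some.inj h).symm, rfl⟩))
    · exact .inr (.inr (.inr (.inl ⟨(Option.some.inj h).symm.trans Sym2.eq_swap, rfl⟩)))
    · exact .inr (.inr (.inr (.inr ⟨(Option.some.inj h).symm, rfl⟩)))
    · simp at h

theorem across_link_ne {x₁ y₁ x₂ y₂ : V} {h₁ : G.Adj x₁ y₁} {h₂ : G.Adj x₂ y₂}
    {hne : s(x₁, y₁) ≠ s(x₂, y₂)} {c : Sym2 V ⊕ ℕ} {a b : V ⊕ Fin 2}
    (h : (across x₁ y₁ x₂ y₂ h₁ h₂ hne).Link c a b) : a ≠ b := by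
  rintro rfl
  rcases across_link_cases h with ⟨x, y, rfl, hy, hadj, -⟩ | h | h | h | h | h
  · exact hadj.ne (Sum.inl_injective hy)
  all_goals
    rcases Sym2.eq_iff.1 h.1 with ⟨rfl, h⟩ | ⟨rfl, h⟩ <;> simp at h

theorem across_link_inj {x₁ y₁ x₂ y₂ : V} {h₁ : G.Adj x₁ y₁} {h₂ : G.Adj x₂ y₂}
    {hne : s(x₁, y₁) ≠ s(x₂, y₂)} {c d : Sym2 V ⊕ ℕ} {a b : V ⊕ Fin 2}
    (h : (across x₁ y₁ x₂ y₂ h₁ h₂ hne).Link c a b)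
    (h' : (across x₁ y₁ x₂ y₂ h₁ h₂ hne).Link d a b) : c = d := by
  have n₁ := h₁.ne
  have n₂ := h₂.ne
  rcases across_link_cases h with ⟨x, y, rfl, rfl, -, -, -, rfl⟩ | h | h | h | h | h <;>
  rcases across_link_cases h' with ⟨x', y', hx, hy, -, -, -, rfl⟩ | h' | h' | h' | h' | h' <;>
  simp_all

/-- The cases are the numbers of new vertices on the triangle. With none it lies in `G`. With one,
its old vertices are the ends of a subdivided edge and are still joined by an unsubdivided one
(`hone`). With two, its old vertex lies on both attached edges (`htwo`). Three new vertices do not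
exist. -/
theorem across_no_triangle {x₁ y₁ x₂ y₂ : V} {h₁ : G.Adj x₁ y₁} {h₂ : G.Adj x₂ y₂}
    {hne : s(x₁, y₁) ≠ s(x₂, y₂)} (hG : ∀ x y z, G.Adj x y → G.Adj y z → ¬ G.Adj z x)
    (hd : ∀ z ∈ s(x₁, y₁), z ∉ s(x₂, y₂)) {c d e : Sym2 V ⊕ ℕ} {a b z : V ⊕ Fin 2}
    (hab : (across x₁ y₁ x₂ y₂ h₁ h₂ hne).Link c a b)
    (hbz : (across x₁ y₁ x₂ y₂ h₁ h₂ hne).Link d b z)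
    (hza : (across x₁ y₁ x₂ y₂ h₁ h₂ hne).Link e z a) : False := by
  have key : ∀ {c a b}, (across x₁ y₁ x₂ y₂ h₁ h₂ hne).Link c a b →
      match a, b with
      | .inl x, .inl y => G.Adj x y ∧ s(x, y) ≠ s(x₁, y₁) ∧ s(x, y) ≠ s(x₂, y₂)
      | .inl x, .inr i => if i = 0 then x ∈ s(x₁, y₁) else x ∈ s(x₂, y₂)
      | .inr i, .inl x => if i = 0 then x ∈ s(x₁, y₁) else x ∈ s(x₂, y₂)
      | .inr i, .inr j => i ≠ j := by
    intro c a b h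
    rcases across_link_cases h with ⟨x, y, rfl, rfl, h, h', h'', -⟩ | h | h | h | h | h
    · exact ⟨h, h', h''⟩
    all_goals
      rcases Sym2.eq_iff.1 h.1 with ⟨rfl, rfl⟩ | ⟨rfl, rfl⟩ <;> simp
  have hone : ∀ {x y : V} {i : Fin 2}, G.Adj x y → s(x, y) ≠ s(x₁, y₁) ∧ s(x, y) ≠ s(x₂, y₂) →
      (if i = 0 then x ∈ s(x₁, y₁) else x ∈ s(x₂, y₂)) →
      (if i = 0 then y ∈ s(x₁, y₁) else y ∈ s(x₂, y₂)) → False := by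
    intro x y i hxy hn hx hy
    split_ifs at hx hy
    · exact hn.1 ((Sym2.mem_and_mem_iff hxy.ne).1 ⟨hx, hy⟩).symm
    · exact hn.2 ((Sym2.mem_and_mem_iff hxy.ne).1 ⟨hx, hy⟩).symm
  have htwo : ∀ {x : V} {i j : Fin 2}, i ≠ j →
      (if i = 0 then x ∈ s(x₁, y₁) else x ∈ s(x₂, y₂)) →
      (if j = 0 then x ∈ s(x₁, y₁) else x ∈ s(x₂, y₂)) → False := by
    intro x i j hij hi hj
    split_ifs at hi hj with h h' h'
    · exact hij (h.trans h'.symm)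
    · exact hd x hi hj
    · exact hd x hj hi
    · omega
  have kab := key hab
  have kbz := key hbz
  have kza := key hza
  rcases a with a | i <;> rcases b with b | j <;> rcases z with z | k
  · exact hG a b z kab.1 kbz.1 kza.1
  · exact hone kab.1 kab.2 kza kbz
  · exact hone kza.1 kza.2 kbz kab
  · exact htwo kbz kab kza
  · exact hone kbz.1 kbz.2 kab kza
  · exact htwo kza kbz kab
  · exact htwo kab kza kbz
  · change i ≠ j at kab
    change j ≠ k at kbz
    change k ≠ i at kza
    omega

theorem four_le_girth_across {x₁ y₁ x₂ y₂ : V} {h₁ : G.Adj x₁ y₁} {h₂ : G.Adj x₂ y₂}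
    {hne : s(x₁, y₁) ≠ s(x₂, y₂)} (hG : ∀ x y z, G.Adj x y → G.Adj y z → ¬ G.Adj z x)
    (hd : ∀ z ∈ s(x₁, y₁), z ∉ s(x₂, y₂)) :
    4 ≤ girth (addEdge G (across x₁ y₁ x₂ y₂ h₁ h₂ hne)) := by
  refine le_iInf ?_
  rintro ⟨n, hn, v, c, hv, hc, hlink⟩
  change ((4 : ℕ) : ℕ∞) ≤ (n : ℕ∞)
  rw [Nat.cast_le]
  by_contra hlt
  obtain rfl | rfl | rfl : n = 1 ∨ n = 2 ∨ n = 3 := by omega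
  · exact across_link_ne (hlink 0) rfl
  · have h0 := hlink 0
    -- In `ZMod 2`, `1 + 1` reduces to `0`, so both edges join `v 0` and `v 1`.
    have h1 : (addEdge G (across x₁ y₁ x₂ y₂ h₁ h₂ hne)).IsLink (c 1) (v 1) (v 0) := hlink 1
    have := hc (across_link_inj h0 h1.symm)
    exact absurd this (by decide)
  · exact across_no_triangle hG hd (hlink 0) (hlink 1) (hlink 2)

end EdgeChoice

/-! ### The automorphism group of `F₁₃` -/

instance : LawfulBEq F13Vertex where
  eq_of_beq {x y} := by revert x y; decide +kernel
  rfl {x} := by revert x; decide +kernel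

/-- The list of neighbours of a vertex of `F₁₃`. -/
def f13Neighbors : F13Vertex → List F13Vertex
  | .inl k => [.inr (1 + Fin.ofNat 9 k), .inr (4 + Fin.ofNat 9 k), .inr (7 + Fin.ofNat 9 k)]
  | .inr i => [.inr (i + 1), .inr (i - 1), .inl (Fin.ofNat 3 i - 1)]

theorem mem_f13Neighbors : ∀ x y, F13.Adj x y → y ∈ f13Neighbors x := by decide +kernel

/-- The vertices of `F₁₃` in the order `A`, `B`, `C`, `1`, …, `9`. -/
def f13Vertices : List F13Vertex := [A, B, C, r 1, r 2, r 3, r 4, r 5, r 6, r 7, r 8, r 9]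

set_option synthInstance.maxHeartbeats 200000 in
set_option synthInstance.maxSize 1024 in
/-- The image of the nine-cycle and its chords is determined by the beginning of the cycle. -/
theorem exists_dihedral_eq_of_neighbors : ∀ a, ∀ w₁ ∈ f13Neighbors a,
    ∀ w₂ ∈ f13Neighbors w₁, w₂ ≠ a → ∀ w₃ ∈ f13Neighbors w₂, w₃ ≠ w₁ →
    ∀ w₄ ∈ f13Neighbors w₃, w₄ ≠ w₂ → w₄ ∈ f13Neighbors a →
    ∀ w₅ ∈ f13Neighbors w₄, w₅ ≠ w₃ → w₅ ≠ a →
    ∀ b ∈ f13Neighbors w₂, b ≠ w₁ → b ≠ w₃ → b ∈ f13Neighbors w₅ →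
    ∀ w₆ ∈ f13Neighbors w₅, w₆ ≠ w₄ → w₆ ≠ b →
    ∀ c ∈ f13Neighbors w₃, c ≠ w₂ → c ≠ w₄ → c ∈ f13Neighbors w₆ →
    ∀ w₇ ∈ f13Neighbors w₆, w₇ ≠ w₅ → w₇ ≠ c → w₇ ∈ f13Neighbors a →
    ∀ w₈ ∈ f13Neighbors w₇, w₈ ≠ w₆ → w₈ ≠ a → w₈ ∈ f13Neighbors b →
    ∀ w₉ ∈ f13Neighbors w₈, w₉ ≠ w₇ → w₉ ≠ b → w₉ ∈ f13Neighbors c →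
    ∃ s j, [a, b, c, w₁, w₂, w₃, w₄, w₅, w₆, w₇, w₈, w₉] = f13Vertices.map (dihedral s j) := by
  decide +kernel

/-- The images of the vertices are searched in the order `A`, 1, 2, 3, 4, 5, `B`, 6, `C`, 7, 8, 9.
Each new image is a neighbour of an earlier one, and the edges that close cycles are tested as soon
as both ends are known, which keeps the finite search small. -/
theorem exists_eq_dihedral (σ : F13 ≃g F13) : ∃ s j, ∀ x, σ x = dihedral s j x := by
  have N : ∀ x y, F13.Adj x y → σ y ∈ f13Neighbors (σ x) := fun x y h =>
    mem_f13Neighbors _ _ (σ.map_adj_iff.2 h)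
  have D : ∀ x y, x ≠ y → σ x ≠ σ y := fun x y h h' => h (σ.injective h')
  obtain ⟨s, j, h⟩ := exists_dihedral_eq_of_neighbors (σ A) (σ (r 1)) (N _ _ (by decide))
    (σ (r 2)) (N _ _ (by decide)) (D _ _ (by decide))
    (σ (r 3)) (N _ _ (by decide)) (D _ _ (by decide))
    (σ (r 4)) (N _ _ (by decide)) (D _ _ (by decide)) (N _ _ (by decide))
    (σ (r 5)) (N _ _ (by decide)) (D _ _ (by decide)) (D _ _ (by decide))
    (σ B) (N _ _ (by decide)) (D _ _ (by decide)) (D _ _ (by decide)) (N _ _ (by decide))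
    (σ (r 6)) (N _ _ (by decide)) (D _ _ (by decide)) (D _ _ (by decide))
    (σ C) (N _ _ (by decide)) (D _ _ (by decide)) (D _ _ (by decide)) (N _ _ (by decide))
    (σ (r 7)) (N _ _ (by decide)) (D _ _ (by decide)) (D _ _ (by decide)) (N _ _ (by decide))
    (σ (r 8)) (N _ _ (by decide)) (D _ _ (by decide)) (D _ _ (by decide)) (N _ _ (by decide))
    (σ (r 9)) (N _ _ (by decide)) (D _ _ (by decide)) (D _ _ (by decide)) (N _ _ (by decide))
  have hmem : ∀ x, x ∈ f13Vertices := by decide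
  refine ⟨s, j, fun x => List.map_inj_left.1 (?_ : f13Vertices.map σ = _) x (hmem x)⟩
  exact h

/-! ### The ten orbits -/

/-- The pairs of edges to which the ten choices of `e` are attached. -/
def tenPairs : Fin 10 → Sym2 F13Vertex × Sym2 F13Vertex :=
  ![(s(A, r 1), s(B, r 2)), (s(A, r 1), s(C, r 3)), (s(A, r 1), s(B, r 5)),
    (s(A, r 1), s(r 2, r 3)), (s(A, r 1), s(r 3, r 4)), (s(A, r 1), s(r 4, r 5)),
    (s(A, r 1), s(r 5, r 6)), (s(r 1, r 2), s(r 3, r 4)), (s(r 1, r 2), s(r 4, r 5)),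
    (s(r 1, r 2), s(r 5, r 6))]

theorem attached_tenCases (k : Fin 10) :
    (tenCases k).attached = {(tenPairs k).1, (tenPairs k).2} := by
  fin_cases k <;> rfl

theorem no_triangle_F13 (x y z : F13Vertex) (hxy : F13.Adj x y) (hyz : F13.Adj y z) :
    ¬ F13.Adj z x := by
  have h : ∀ x, ∀ y ∈ f13Neighbors x, ∀ z ∈ f13Neighbors y, x ∉ f13Neighbors z := by
    decide +kernel
  exact fun hzx => h x y (mem_f13Neighbors _ _ hxy) z (mem_f13Neighbors _ _ hyz)
    (mem_f13Neighbors _ _ hzx)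

theorem four_le_girth_tenCases (k : Fin 10) : 4 ≤ girth (addEdge F13 (tenCases k)) := by
  fin_cases k <;> exact EdgeChoice.four_le_girth_across no_triangle_F13 (by decide)

/-- Dropping the three orbits of pairs with a common end leaves exactly the ten listed ones. -/
theorem exists_tenPairs : ∀ f ∈ [s(r 1, r 2), s(A, r 1)], ∀ g ∈ f13Edges,
    (∀ z : F13Vertex, z ∈ f → z ∉ g) → ∃ k b j,
      (Sym2.map (dihedral b j) f = (tenPairs k).1 ∧ Sym2.map (dihedral b j) g = (tenPairs k).2) ∨
      (Sym2.map (dihedral b j) f = (tenPairs k).2 ∧ Sym2.map (dihedral b j) g = (tenPairs k).1) := by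
  decide +kernel

theorem tenPairs_unique : ∀ k l b j,
    (Sym2.map (dihedral b j) (tenPairs k).1 = (tenPairs l).1 ∧
      Sym2.map (dihedral b j) (tenPairs k).2 = (tenPairs l).2) ∨
    (Sym2.map (dihedral b j) (tenPairs k).1 = (tenPairs l).2 ∧
      Sym2.map (dihedral b j) (tenPairs k).2 = (tenPairs l).1) → k = l := by
  decide +kernel

theorem exists_tenCases {e : EdgeChoice F13} (he : 4 ≤ girth (addEdge F13 e)) :
    ∃ k, ∃ σ : F13 ≃g F13, Sym2.map σ '' e.attached = (tenCases k).attached := by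
  cases e with
  | pendant x y h =>
    exact absurd (EdgeChoice.hasCycle_pendant x y h)
      (not_hasCycle_of_le_girth (m := 4) he (by norm_num))
  | same x y h =>
    exact absurd (EdgeChoice.hasCycle_same x y h)
      (not_hasCycle_of_le_girth (m := 4) he (by norm_num))
  | across x₁ y₁ x₂ y₂ h₁ h₂ hne =>
    have hd : ∀ z ∈ s(x₁, y₁), z ∉ s(x₂, y₂) := fun z hz hz' =>
      not_hasCycle_of_le_girth (m := 4) he (by norm_num) (EdgeChoice.hasCycle_across hz hz')
    obtain ⟨b, j, hbj⟩ := exists_dihedral_edge s(x₁, y₁) h₁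
    obtain ⟨k, c, l, hcl⟩ := exists_tenPairs (Sym2.map (dihedral b j) s(x₁, y₁))
      (by simpa using hbj) (Sym2.map (dihedral b j) s(x₂, y₂)) (map_dihedral_mem b j _ h₂) (by
        intro z hz hz'
        obtain ⟨x, hx, rfl⟩ := Sym2.mem_map.1 hz
        obtain ⟨y, hy, hyx⟩ := Sym2.mem_map.1 hz'
        exact hd x hx (dihedral_injective b j hyx ▸ hy))
    refine ⟨k, (dihedralIso b j).trans (dihedralIso c l), ?_⟩
    rw [attached_tenCases, EdgeChoice.attached, image_pair, Set.pair_eq_pair_iff]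
    exact hcl

theorem tenCases_unique {S : Set (Sym2 F13Vertex)} {k l : Fin 10} {σ τ : F13 ≃g F13}
    (hσ : Sym2.map σ '' S = (tenCases k).attached) (hτ : Sym2.map τ '' S = (tenCases l).attached) :
    k = l := by
  -- This automorphism carries the `k`-th pair to the `l`-th. Being dihedral, it falls under the
  -- finite check `tenPairs_unique`.
  obtain ⟨b, j, hbj⟩ := exists_eq_dihedral (σ.symm.trans τ)
  have hfun : ⇑(σ.symm.trans τ) = dihedral b j := funext hbj
  have hS : Sym2.map (σ.symm.trans τ) '' (tenCases k).attached = (tenCases l).attached := by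
    rw [← hσ, ← hτ, image_image]
    refine image_congr fun f _ => ?_
    rw [Sym2.map_map]
    exact Sym2.map_congr fun x _ => congrArg τ (σ.symm_apply_apply x)
  rw [attached_tenCases, attached_tenCases, hfun, image_pair, Set.pair_eq_pair_iff] at hS
  exact tenPairs_unique k l b j hS

end ToroidalGraphs

open ToroidalGraphs in
theorem mainTheorem8 :
    (∀ e : EdgeChoice F13, Toroidal (addEdge F13 e)) ∧
    (∀ k : Fin 10, 4 ≤ girth (addEdge F13 (tenCases k))) ∧
    (∀ e : EdgeChoice F13, 4 ≤ girth (addEdge F13 e) →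
      ∃! k : Fin 10, ∃ σ : F13 ≃g F13, Sym2.map σ '' e.attached = (tenCases k).attached) := by
  refine ⟨toroidal_addEdge_F13, four_le_girth_tenCases, fun e he => ?_⟩
  obtain ⟨k, σ, hσ⟩ := exists_tenCases he
  exact ⟨k, ⟨σ, hσ⟩, fun l ⟨τ, hτ⟩ => tenCases_unique hτ hσ⟩
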